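/- A compact metric graph $\mathcal G$ is a finite connected graph (multiple edges and self-loops allowed) in which every edge $e$ is identified with an interval $[0,L_e]$, $0<L_e<\infty$; $|\mathcal G|=\sum_e L_e$ is its total length. $H^1(\mathcal G)$ is the space of complex functions on $\mathcal G$ that are $H^1$ on every edge and continuous at the vertices. For $u\in H^1(\mathcal G)$ let $$E(u)=\frac12\int_{\mathcal G}|u'|^2\,dx-\frac1p\int_{\mathcal G}|u|^p\,dx,\qquad H^1_\mu(\mathcal G)=\{u\in H^1(\mathcal G):\ \|u\|_2^2=\mu\},$$ and for $\mu>0$ let $\kappa_\mu=\sqrt{\mu/|\mathcal G|}\in H^1_\mu(\mathcal G)$ be the constant function of mass $\mu$. Let $\mu_1(\mathcal G,p)$ be the threshold mass such that $\kappa_\mu$ is a local minimizer of $E$ in $H^1_\mu(\mathcal G)$ (in the $H^1$ norm) for $\mu<\mu_1(\mathcal G,p)$ and is not one for $\mu>\mu_1(\mathcal G,p)$; that is, $\mu_1(\mathcal G,p)$ is the supremum of the masses $\mu>0$ for which $\kappa_\mu$ is a local minimizer of $E$ in $H^1_\mu(\mathcal G)$. A terminal edge is an edge with an endpoint of degree $1$;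 a bridging edge is an edge whose removal disconnects the graph; a graph has a cycle covering if every edge lies on a cycle, i.e. on a closed path without repeated edges. **Theorem.** Let $(\mathcal G_\ell)_{\ell>0}$ be compact metric graphs with the same underlying finite connected graph, which has no terminal edge and no cycle covering, such that the lengths of the non-bridging edges do not depend on $\ell$ and the longest bridging edge of $\mathcal G_\ell$ has length $\ell$. (i) If the lengths of the bridging edges other than one of length $\ell$ stay bounded independently of $\ell$ (in particular, if there is only one bridging edge), then $$\lim_{\ell\to+\infty}\mu_1(\mathcal G_\ell,6)=\frac{\pi}{2}.$$ (ii) In all cases $$\liminf_{\ell\to0^+}\mu_1(\mathcal G_\ell,6)\ \ge\ \pi.$$ -/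

import Mathlib

open Set Filter Topology MeasureTheory

/-- The combinatorial part of a metric graph with vertex set `V` and edge set `E`: every edge has an
initial and a final vertex, so that it can be identified with an interval `[0, L e]`. Multiple edges
and self-loops are allowed; the orientation only serves to parametrize the edges. -/
structure MGraph (V E : Type*) where
  /-- the vertex at the coordinate `0` of an edge -/
  src : E → V
  /-- the vertex at the coordinate `L e` of an edge -/
  tgt : E → V

namespace MGraph

variable {V E : Type*}

/-- The two vertices are joined by a (possibly trivial) path, traversing edges of `S` in any
direction. -/
def JoinedIn (Γ : MGraph V E) (S : Set E) (x y : V) : Prop :=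
  Relation.EqvGen (fun a b => ∃ e ∈ S, Γ.src e = a ∧ Γ.tgt e = b) x y

/-- The graph is connected. -/
def IsConnected (Γ : MGraph V E) : Prop :=
  Nonempty V ∧ ∀ x y, Γ.JoinedIn Set.univ x y

/-- A bridging edge (of a connected graph): its removal disconnects the graph. -/
def IsBridging (Γ : MGraph V E) (e : E) : Prop :=
  ¬ ∀ x y, Γ.JoinedIn {e}ᶜ x y

/-- The degree of a vertex; a self-loop counts twice. -/
noncomputable def degree (Γ : MGraph V E) (x : V) : ℕ :=
  {e | Γ.src e = x}.ncard + {e | Γ.tgt e = x}.ncard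

/-- A terminal edge: one of its endpoints has degree one. -/
def IsTerminal (Γ : MGraph V E) (e : E) : Prop :=
  Γ.degree (Γ.src e) = 1 ∨ Γ.degree (Γ.tgt e) = 1

/-- The starting vertex of an edge traversed forwards (`true`) or backwards (`false`). -/
def dartStart (Γ : MGraph V E) (d : E × Bool) : V :=
  if d.2 then Γ.src d.1 else Γ.tgt d.1

/-- The final vertex of an edge traversed forwards (`true`) or backwards (`false`). -/
def dartEnd (Γ : MGraph V E) (d : E × Bool) : V :=
  if d.2 then Γ.tgt d.1 else Γ.src d.1

/-- A cycle, i.e. a closed path without edge repetitions. The index `i + 1` is cyclic in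
`Fin (n + 1)`, so the last edge ends where the first one starts. -/
structure IsCycle (Γ : MGraph V E) {n : ℕ} (d : Fin (n + 1) → E × Bool) : Prop where
  chain : ∀ i, Γ.dartEnd (d i) = Γ.dartStart (d (i + 1))
  no_repetition : Function.Injective (fun i => (d i).1)

/-- The graph admits a cycle covering: every edge lies on a cycle. -/
def HasCycleCovering (Γ : MGraph V E) : Prop :=
  ∀ e, ∃ (n : ℕ) (d : Fin (n + 1) → E × Bool), Γ.IsCycle d ∧ ∃ i, (d i).1 = e

/-- The complex Sobolev space `H¹` of the metric graph in which the edge `e` is the interval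
`[0, L e]`. An element is a function on the edges with its weak derivative: on every edge the weak
derivative is square integrable, the function is its primitive, and the values at the endpoints of
the edges agree at the vertices (continuity on the graph). -/
structure H1 (Γ : MGraph V E) (L : E → ℝ) where
  /-- the function -/
  toFun : E → ℝ → ℂ
  /-- its weak derivative -/
  wderiv : E → ℝ → ℂ
  memLp_wderiv : ∀ e, MemLp (wderiv e) 2 (volume.restrict (Ioc 0 (L e)))
  eq_primitive : ∀ e, ∀ x ∈ Icc 0 (L e), toFun e x = toFun e 0 + ∫ t in (0 : ℝ)..x, wderiv e t
  continuous_at_vertices :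
    ∃ v : V → ℂ, ∀ e, toFun e 0 = v (Γ.src e) ∧ toFun e (L e) = v (Γ.tgt e)

/-- The constant functions in `H¹`. -/
def H1.const (Γ : MGraph V E) (L : E → ℝ) (c : ℂ) : Γ.H1 L where
  toFun := fun _ _ => c
  wderiv := fun _ _ => 0
  memLp_wderiv := fun _ => MemLp.zero'
  eq_primitive := by intros; simp
  continuous_at_vertices := ⟨fun _ => c, fun _ => ⟨rfl, rfl⟩⟩

variable [Fintype E] {Γ : MGraph V E} {L : E → ℝ}

/-- The mass `‖u‖₂²`. -/
noncomputable def H1.mass (u : Γ.H1 L) : ℝ :=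
  ∑ e, ∫ x in (0 : ℝ)..(L e), ‖u.toFun e x‖ ^ 2

/-- The NLS energy `½ ‖u'‖₂² - (1/p) ‖u‖ₚᵖ`. -/
noncomputable def H1.energy (p : ℝ) (u : Γ.H1 L) : ℝ :=
  1 / 2 * (∑ e, ∫ x in (0 : ℝ)..(L e), ‖u.wderiv e x‖ ^ 2)
    - 1 / p * ∑ e, ∫ x in (0 : ℝ)..(L e), ‖u.toFun e x‖ ^ p

/-- The distance of two functions in the `H¹` norm. -/
noncomputable def H1.dist (u w : Γ.H1 L) : ℝ :=
  Real.sqrt ((∑ e, ∫ x in (0 : ℝ)..(L e), ‖u.toFun e x - w.toFun e x‖ ^ 2)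
    + ∑ e, ∫ x in (0 : ℝ)..(L e), ‖u.wderiv e x - w.wderiv e x‖ ^ 2)

/-- `u` is a local minimizer of the energy among the functions of `H¹` with the same mass, with
respect to the `H¹` norm. -/
def H1.IsLocalMinimizer (p : ℝ) (u : Γ.H1 L) : Prop :=
  ∃ ε > 0, ∀ w : Γ.H1 L, w.mass = u.mass → w.dist u < ε → u.energy p ≤ w.energy p

/-- The constant function `κ_μ = √(μ / |𝒢|)` of mass `μ`, where `|𝒢|` is the total length. -/
noncomputable def kappa (Γ : MGraph V E) (L : E → ℝ) (μ : ℝ) : Γ.H1 L :=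
  H1.const Γ L (Real.sqrt (μ / ∑ e, L e) : ℝ)

/-- The threshold mass `μ₁(𝒢, p)`: the constant function `κ_μ` is a local minimizer of the energy at
fixed mass for the masses `μ` below it, and is not for the masses above it. -/
noncomputable def mu1 (Γ : MGraph V E) (L : E → ℝ) (p : ℝ) : ℝ :=
  sSup {μ : ℝ | 0 < μ ∧ (Γ.kappa L μ).IsLocalMinimizer p}

end MGraph

/-! Let `q = μ / |𝒢|`. For `p = 6` the second variation at the constant is governed by comparing
`(2q)²` with the spectral gap `λ` of the Laplacian on the graph, i.e. the best constant in `λ ∫ ψ² ≤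
∫ ψ'²` for `ψ` of mean zero. The theorem thus reduces to two bounds on the gap: `λ ≥ (kπ / ∑ ω² L)²`
for suitable edge weights `ω`, and a trial function on a bridging edge.

Lower bound on `μ₁`. Give the edges weights `ω ≥ 1` such that every cut of the vertices has weight
at least `k`, with `k ≤ 2`. A coarea argument (`CutWeightGE.coarea`) bounds the weighted variation
of a function from below by `k` times its oscillation. It is applied to `H ∘ ρ`, where `H' = √(A² -
(t - c)²)` is the slope that a sinusoid of amplitude `A` about `c` has at height `t`, up to its
frequency. Calibration by `H` turns this into the Poincaré inequality `CutWeightGE.poincare`.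
Applied to the density `|w|²` of a competitor, it gives local minimality
(`CutWeightGE.isLocalMinimizer_kappa`), hence `μ₁ ≥ (kπ/2) |𝒢| / ∑ ω² L`. Weights `1` with `k = 1`
give `μ₁ ≥ π/2` on every graph considered. Weight `2` on the bridging edges and `1` elsewhere, with
`k = 2`, give a bound that tends to `π` when the bridging edges shrink, since some edge of fixed
length remains: a finite tree with an edge has a terminal edge.

Upper bound on `μ₁`. A half period of the cosine on a bridging edge `e₀`, extended by `1` and `-1`
to the two sides, gives `μ₁ ≤ π |𝒢| / (2 L e₀)`. In (i) the ratio `|𝒢| / ℓ` tends to `1`, so the two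
bounds meet. -/

/-! ### Total variation and calibration on an interval -/

theorem LipschitzWith.comp_absolutelyContinuousOnInterval {H ρ : ℝ → ℝ} {K : NNReal} {a b : ℝ}
    (hH : LipschitzWith K H) (hρ : AbsolutelyContinuousOnInterval ρ a b) :
    AbsolutelyContinuousOnInterval (fun x => H (ρ x)) a b := by
  have h := (show Tendsto _ _ _ from hρ).const_mul (K : ℝ)
  rw [mul_zero] at h
  refine squeeze_zero (fun _ => Finset.sum_nonneg fun _ _ => dist_nonneg) (fun I => ?_) h
  rw [Finset.mul_sum]
  exact Finset.sum_le_sum fun i _ => hH.dist_le_mul _ _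

theorem AbsolutelyContinuousOnInterval.abs_sub_le_integral_abs_deriv {h : ℝ → ℝ} {a b x y : ℝ}
    (hh : AbsolutelyContinuousOnInterval h a b) (hax : a ≤ x) (hxy : x ≤ y) (hyb : y ≤ b) :
    |h y - h x| ≤ ∫ t in x..y, |deriv h t| := by
  have h1 : AbsolutelyContinuousOnInterval h x y := hh.mono (by
    rw [uIcc_of_le hxy, uIcc_of_le (hax.trans (hxy.trans hyb))]
    exact Icc_subset_Icc hax hyb)
  rw [← h1.integral_deriv_eq_sub]
  exact intervalIntegral.abs_integral_le_integral_abs hxy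

/-- The total variation of `h` on an interval, traversed through two given points. -/
theorem AbsolutelyContinuousOnInterval.two_mul_sub_le_integral_abs_deriv {h : ℝ → ℝ} {a b x y : ℝ}
    (hh : AbsolutelyContinuousOnInterval h a b) (hx : x ∈ Icc a b) (hy : y ∈ Icc a b) :
    2 * (h x - h y) - |h a - h b| ≤ ∫ t in a..b, |deriv h t| := by
  -- The variation is at least that of the broken path `a → x → y → b`. In either order of the two
  -- points, the triangle inequality then gives the bound.
  have key : ∀ {x y}, x ∈ Icc a b → y ∈ Icc a b → x ≤ y →
      |h x - h a| + |h y - h x| + |h b - h y| ≤ ∫ t in a..b, |deriv h t| := by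
    intro x y hx hy hxy
    have hab : a ≤ b := hx.1.trans hx.2
    have hi : IntervalIntegrable (fun t => |deriv h t|) volume a b := hh.intervalIntegrable_deriv.abs
    have hi' : ∀ {c d}, c ∈ Icc a b → d ∈ Icc a b →
        IntervalIntegrable (fun t => |deriv h t|) volume c d := fun {c d} hc hd =>
      hi.mono_set (by
        rw [uIcc_of_le hab]
        exact uIcc_subset_Icc hc hd)
    have ha : a ∈ Icc a b := left_mem_Icc.2 hab
    have hb : b ∈ Icc a b := right_mem_Icc.2 hab
    rw [← intervalIntegral.integral_add_adjacent_intervals (hi' ha hy) (hi' hy hb),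
      ← intervalIntegral.integral_add_adjacent_intervals (hi' ha hx) (hi' hx hy)]
    exact add_le_add (add_le_add (hh.abs_sub_le_integral_abs_deriv le_rfl hx.1 hx.2)
      (hh.abs_sub_le_integral_abs_deriv hx.1 hxy hy.2))
      (hh.abs_sub_le_integral_abs_deriv hy.1 hy.2 le_rfl)
  rcases le_total x y with hxy | hxy
  · have := key hx hy hxy
    have := neg_abs_le (h x - h a)
    have := le_abs_self (h x - h a)
    have := neg_abs_le (h y - h x)
    have := le_abs_self (h b - h y)
    have := le_abs_self (h a - h b)
    linarith
  · have := key hy hx hxy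
    have := neg_abs_le (h y - h a)
    have := le_abs_self (h x - h y)
    have := neg_abs_le (h b - h x)
    have := neg_abs_le (h a - h b)
    linarith

/-- A lower bound of the Dirichlet energy by calibration: `H` is a primitive of `g`. -/
theorem AbsolutelyContinuousOnInterval.calibration_le_integral_sq_deriv {ρ H g : ℝ → ℝ}
    {K : NNReal} {a b x y ω : ℝ} (hρ : AbsolutelyContinuousOnInterval ρ a b)
    (hsq : IntervalIntegrable (fun t => deriv ρ t ^ 2) volume a b)
    (hH : LipschitzWith K H) (hd : ∀ t, HasDerivAt H (g t) t) (hg : Continuous g)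
    (hg0 : ∀ t, 0 ≤ g t) (hω : 0 ≤ ω) (hx : x ∈ Icc a b) (hy : y ∈ Icc a b) :
    2 * ω * (2 * (H (ρ x) - H (ρ y)) - |H (ρ a) - H (ρ b)|)
      - ω ^ 2 * ∫ t in a..b, g (ρ t) ^ 2 ≤ ∫ t in a..b, deriv ρ t ^ 2 := by
  have hab : a ≤ b := hx.1.trans hx.2
  have hac := hH.comp_absolutelyContinuousOnInterval hρ
  have htv := hac.two_mul_sub_le_integral_abs_deriv hx hy
  have hder : ∀ᵐ t, t ∈ uIoc a b → |deriv (fun t => H (ρ t)) t| = g (ρ t) * |deriv ρ t| := by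
    filter_upwards [hρ.ae_differentiableAt] with t ht hmem
    have := ((hd (ρ t)).comp t (ht (uIoc_subset_uIcc hmem)).hasDerivAt).deriv
    rw [show (fun t => H (ρ t)) = H ∘ ρ from rfl, this, abs_mul, abs_of_nonneg (hg0 _)]
  have hcont : ContinuousOn (fun t => g (ρ t)) (uIcc a b) :=
    hg.comp_continuousOn hρ.continuousOn
  have hi1 : IntervalIntegrable (fun t => g (ρ t) * |deriv ρ t|) volume a b :=
    hρ.intervalIntegrable_deriv.abs.continuousOn_mul hcont
  have hi2 : IntervalIntegrable (fun t => g (ρ t) ^ 2) volume a b :=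
    (hcont.pow 2).intervalIntegrable
  rw [intervalIntegral.integral_congr_ae hder] at htv
  have hmono : ∫ t in a..b, (2 * ω * (g (ρ t) * |deriv ρ t|) - ω ^ 2 * g (ρ t) ^ 2)
      ≤ ∫ t in a..b, deriv ρ t ^ 2 := by
    refine intervalIntegral.integral_mono_on hab ((hi1.const_mul _).sub (hi2.const_mul _)) hsq ?_
    intro t _
    -- Completing the square: equality holds exactly when `|ρ'| = ω g(ρ)`, which for the half-circle
    -- profile is the equation of a sinusoid of frequency `ω`.
    have := sq_nonneg (|deriv ρ t| - ω * g (ρ t))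
    have h2 := sq_abs (deriv ρ t)
    nlinarith
  rw [intervalIntegral.integral_sub (hi1.const_mul _) (hi2.const_mul _),
    intervalIntegral.integral_const_mul, intervalIntegral.integral_const_mul] at hmono
  refine le_trans ?_ hmono
  gcongr

/-- The half-circle profile of centre `c` and radius `A`. -/
noncomputable def semicircle (c A t : ℝ) : ℝ := √(A ^ 2 - (t - c) ^ 2)

theorem continuous_semicircle (c A : ℝ) : Continuous (semicircle c A) := by
  unfold semicircle; fun_prop

theorem semicircle_sq {c A t : ℝ} (h : |t - c| ≤ A) :
    semicircle c A t ^ 2 = A ^ 2 - (t - c) ^ 2 := by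
  refine Real.sq_sqrt (sub_nonneg.2 ?_)
  rw [← sq_abs (t - c)]
  gcongr

/-- The area of a half disc; the `π` of the Poincaré constant comes from here. -/
theorem integral_semicircle {c A : ℝ} (hA : 0 ≤ A) :
    ∫ t in (c - A)..(c + A), semicircle c A t = Real.pi * A ^ 2 / 2 := by
  rcases hA.eq_or_lt with rfl | hA
  · simp
  have h := intervalIntegral.integral_comp_mul_add (a := -1) (b := 1) (semicircle c A) hA.ne' c
  have h2 : ∀ x : ℝ, semicircle c A (A * x + c) = A * √(1 - x ^ 2) := by
    intro x
    rw [semicircle, show A ^ 2 - (A * x + c - c) ^ 2 = A ^ 2 * (1 - x ^ 2) by ring,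
      Real.sqrt_mul (sq_nonneg A), Real.sqrt_sq hA.le]
  simp only [h2, intervalIntegral.integral_const_mul, integral_sqrt_one_sub_sq, smul_eq_mul] at h
  rw [show A * -1 + c = c - A by ring, show A * 1 + c = c + A by ring] at h
  field_simp at h
  linarith

theorem hasDerivAt_integral_semicircle (c A t : ℝ) :
    HasDerivAt (fun t => ∫ s in c..t, semicircle c A s) (semicircle c A t) t :=
  intervalIntegral.integral_hasDerivAt_right ((continuous_semicircle c A).intervalIntegrable _ _)
    ((continuous_semicircle c A).stronglyMeasurableAtFilter _ _)
    (continuous_semicircle c A).continuousAt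

theorem semicircle_le (c A t : ℝ) : semicircle c A t ≤ |A| := by
  rw [semicircle, ← Real.sqrt_sq_eq_abs]
  exact Real.sqrt_le_sqrt (by nlinarith [sq_nonneg (t - c)])

theorem lipschitzWith_integral_semicircle (c A : ℝ) :
    LipschitzWith ‖A‖₊ (fun t => ∫ s in c..t, semicircle c A s) := by
  refine lipschitzWith_of_nnnorm_deriv_le
    (fun t => (hasDerivAt_integral_semicircle c A t).differentiableAt) fun t => ?_
  rw [(hasDerivAt_integral_semicircle c A t).deriv, ← NNReal.coe_le_coe, coe_nnnorm, coe_nnnorm,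
    Real.norm_of_nonneg (show 0 ≤ semicircle c A t from Real.sqrt_nonneg _)]
  exact semicircle_le c A t

/-! ### Weighted cuts and the coarea inequality -/

namespace MGraph

variable {V E : Type*} {Γ : MGraph V E}

/-- The edge joins the set `S` with its complement. -/
def Crosses (Γ : MGraph V E) (S : Set V) (e : E) : Prop := ¬ (Γ.src e ∈ S ↔ Γ.tgt e ∈ S)

open Classical in
/-- With the edge weights `ω`, every cut of the graph has weight at least `k`. -/
def CutWeightGE [Fintype E] (Γ : MGraph V E) (ω : E → ℝ) (k : ℝ) : Prop :=
  ∀ S : Set V, S.Nonempty → Sᶜ.Nonempty → k ≤ ∑ e, if Γ.Crosses S e then ω e else 0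

theorem JoinedIn.mem_iff {T : Set E} {S : Set V} (hS : ∀ e ∈ T, ¬ Γ.Crosses S e) {x y : V}
    (h : Γ.JoinedIn T x y) : x ∈ S ↔ y ∈ S := by
  induction h with
  | rel a b h =>
    obtain ⟨e, he, rfl, rfl⟩ := h
    exact not_not.1 (hS e he)
  | refl => rfl
  | symm _ _ _ ih => exact ih.symm
  | trans _ _ _ _ _ ih ih' => exact ih.trans ih'

theorem IsConnected.exists_crosses (h : Γ.IsConnected) {S : Set V} (hS : S.Nonempty)
    (hS' : Sᶜ.Nonempty) : ∃ e, Γ.Crosses S e := by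
  by_contra! hc
  obtain ⟨x, hx⟩ := hS
  obtain ⟨y, hy⟩ := hS'
  exact hy (((h.2 x y).mem_iff fun e _ => hc e).1 hx)

/-- If `e` were the only edge across the cut, its removal would separate `S` from its complement. -/
theorem exists_crosses_ne {S : Set V} (hS : S.Nonempty) (hS' : Sᶜ.Nonempty) {e : E}
    (he : ¬ Γ.IsBridging e) : ∃ e' ≠ e, Γ.Crosses S e' := by
  by_contra! hc
  obtain ⟨x, hx⟩ := hS
  obtain ⟨y, hy⟩ := hS'
  exact hy (((not_not.1 he x y).mem_iff fun e' h' => hc e' h').1 hx)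

variable [Fintype E]

theorem IsConnected.cutWeightGE_one (h : Γ.IsConnected) : Γ.CutWeightGE (fun _ => 1) 1 := by
  classical
  intro S hS hS'
  obtain ⟨e, he⟩ := h.exists_crosses hS hS'
  calc (1 : ℝ) = if Γ.Crosses S e then 1 else 0 := by rw [if_pos he]
    _ ≤ _ := by
      convert Finset.single_le_sum (f := fun e => if Γ.Crosses S e then (1 : ℝ) else 0)
        (fun i _ => by positivity) (Finset.mem_univ e)

open Classical in
/-- The weight `2` on the bridging edges and `1` on the other ones. -/
noncomputable def bridgeWeight (Γ : MGraph V E) (e : E) : ℝ := if Γ.IsBridging e then 2 else 1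

omit [Fintype E] in
theorem one_le_bridgeWeight (e : E) : 1 ≤ Γ.bridgeWeight e := by
  unfold bridgeWeight; split_ifs <;> norm_num

/-- A bridging edge across the cut carries weight `2` on its own; a non-bridging one is accompanied
by a second edge across the cut. -/
theorem IsConnected.cutWeightGE_two (h : Γ.IsConnected) : Γ.CutWeightGE Γ.bridgeWeight 2 := by
  classical
  intro S hS hS'
  have h0 : ∀ i, 0 ≤ if Γ.Crosses S i then Γ.bridgeWeight i else 0 := fun i => by
    split_ifs
    · exact zero_le_one.trans (one_le_bridgeWeight i)
    · rfl
  obtain ⟨e, he⟩ := h.exists_crosses hS hS'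
  by_cases hb : Γ.IsBridging e
  · have := Finset.single_le_sum (f := fun e => if Γ.Crosses S e then Γ.bridgeWeight e else 0)
        (fun i _ => h0 i) (Finset.mem_univ e)
    rw [if_pos he, show Γ.bridgeWeight e = 2 from if_pos hb] at this
    refine this.trans (le_of_eq ?_)
    congr!
  · obtain ⟨e', hne, he'⟩ := exists_crosses_ne hS hS' hb
    have := Finset.sum_le_sum_of_subset_of_nonneg (Finset.subset_univ {e, e'})
      (f := fun e => if Γ.Crosses S e then Γ.bridgeWeight e else 0) (fun i _ _ => h0 i)
    rw [Finset.sum_pair hne.symm, if_pos he, if_pos he'] at this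
    have h1 := one_le_bridgeWeight (Γ := Γ) e
    have h2 := one_le_bridgeWeight (Γ := Γ) e'
    refine le_trans ?_ (this.trans (le_of_eq ?_))
    · linarith
    · congr!

theorem integral_indicator_Ico {a b : ℝ} (h : a ≤ b) :
    ∫ t, (Ico a b).indicator (fun _ => (1 : ℝ)) t = b - a := by
  rw [integral_indicator measurableSet_Ico]
  simp [h]

theorem integrable_indicator_Ico (a b : ℝ) :
    Integrable ((Ico a b).indicator (fun _ => (1 : ℝ))) := by
  rw [integrable_indicator_iff measurableSet_Ico]
  exact integrableOn_const (by simp)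

/-- A discrete coarea inequality: a function with range `[lo e, hi e]` on the edge `e`
crosses every level between its extrema with total weight at least `k`. -/
theorem CutWeightGE.coarea {ω : E → ℝ} {k : ℝ} (hcut : Γ.CutWeightGE ω k) (hω : ∀ e, 1 ≤ ω e)
    (hk0 : 0 ≤ k) (hk : k ≤ 2) (h : V → ℝ) (lo hi : E → ℝ)
    (hsrc : ∀ e, h (Γ.src e) ∈ Icc (lo e) (hi e)) (htgt : ∀ e, h (Γ.tgt e) ∈ Icc (lo e) (hi e))
    (i j : E) :
    k * (hi i - lo j) ≤
      ∑ e, ω e * (2 * (hi e - lo e) - |h (Γ.src e) - h (Γ.tgt e)|) := by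
  classical
  have habs : ∀ e, |h (Γ.src e) - h (Γ.tgt e)| ≤ hi e - lo e := fun e => by
    rw [abs_le]
    constructor <;> linarith [(hsrc e).1, (hsrc e).2, (htgt e).1, (htgt e).2]
  have hle : ∀ e, lo e ≤ hi e := fun e => (hsrc e).1.trans (hsrc e).2
  have hnn : 0 ≤ ∑ e, ω e * (2 * (hi e - lo e) - |h (Γ.src e) - h (Γ.tgt e)|) :=
    Finset.sum_nonneg fun e _ => mul_nonneg (zero_le_one.trans (hω e))
      (by linarith [habs e, hle e])
  rcases le_total (hi i) (lo j) with hij | hij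
  · exact (mul_nonpos_of_nonneg_of_nonpos hk0 (sub_nonpos.2 hij)).trans hnn
  -- `n e t` is a lower count of the passages of the edge through the level `t`: one if `t`
  -- separates the endpoint values, two if `t` is only in the range, zero otherwise. The half-open
  -- intervals match the superlevel sets `t < h v`, so that an edge crosses such a set exactly when
  -- `t` separates its endpoint values.
  let n : E → ℝ → ℝ := fun e t => 2 * (Ico (lo e) (hi e)).indicator (fun _ => (1 : ℝ)) t
    - (Ico (min (h (Γ.src e)) (h (Γ.tgt e))) (max (h (Γ.src e)) (h (Γ.tgt e)))).indicator
      (fun _ => (1 : ℝ)) t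
  have hnint : ∀ e, Integrable (n e) := fun e =>
    ((integrable_indicator_Ico _ _).const_mul 2).sub (integrable_indicator_Ico _ _)
  have hnval : ∀ e, ∫ t, n e t = 2 * (hi e - lo e) - |h (Γ.src e) - h (Γ.tgt e)| := fun e => by
    simp only [n]
    rw [integral_sub ((integrable_indicator_Ico _ _).const_mul 2) (integrable_indicator_Ico _ _),
      integral_const_mul, integral_indicator_Ico (hle e), integral_indicator_Ico min_le_max,
      max_sub_min_eq_abs, abs_sub_comm]
  have hsub : ∀ e t, t ∈ Ico (min (h (Γ.src e)) (h (Γ.tgt e))) (max (h (Γ.src e)) (h (Γ.tgt e))) →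
      t ∈ Ico (lo e) (hi e) := fun e t ht =>
    ⟨(le_min (hsrc e).1 (htgt e).1).trans ht.1, ht.2.trans_le (max_le (hsrc e).2 (htgt e).2)⟩
  have hn0 : ∀ e t, 0 ≤ n e t := fun e t => by
    simp only [n, indicator_apply]
    have := hsub e t
    split_ifs <;> first | exact absurd (this ‹_›) ‹_› | norm_num
  have hωn : ∀ e t, 0 ≤ ω e * n e t := fun e t => mul_nonneg (zero_le_one.trans (hω e)) (hn0 e t)
  have hkey : ∀ t, k * (Ico (lo j) (hi i)).indicator (fun _ => (1 : ℝ)) t ≤ ∑ e, ω e * n e t := by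
    intro t
    by_cases ht : t ∈ Ico (lo j) (hi i)
    swap
    · rw [indicator_of_notMem ht, mul_zero]
      exact Finset.sum_nonneg fun e _ => hωn e t
    rw [indicator_of_mem ht, mul_one]
    have hsingle : ∀ e, t ∈ Ico (lo e) (hi e) →
        t ∉ Ico (min (h (Γ.src e)) (h (Γ.tgt e))) (max (h (Γ.src e)) (h (Γ.tgt e))) →
        k ≤ ∑ e, ω e * n e t := by
      intro e h1 h2
      refine le_trans ?_ (Finset.single_le_sum (fun e _ => hωn e t) (Finset.mem_univ e))
      simp only [n, indicator_of_mem h1, indicator_of_notMem h2]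
      linarith [hω e]
    -- Either the superlevel set is a genuine cut, or all vertices lie on one side of the level. In
    -- the latter case the edge `j` or `i`, which goes past the level and returns, counts twice, and
    -- `k ≤ 2` suffices.
    by_cases hS : {v | t < h v}.Nonempty
    · by_cases hS' : {v | t < h v}ᶜ.Nonempty
      · refine (hcut _ hS hS').trans (Finset.sum_le_sum fun e _ => ?_)
        split_ifs with hc
        · have hmem : t ∈ Ico (min (h (Γ.src e)) (h (Γ.tgt e)))
              (max (h (Γ.src e)) (h (Γ.tgt e))) := by
            simp only [Crosses, mem_ofPred_eq] at hc
            rw [mem_Ico, min_le_iff, lt_max_iff]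
            by_contra hcon
            apply hc
            constructor <;> intro h' <;> by_contra h'' <;> push Not at h'' <;> apply hcon
            · exact ⟨Or.inr h'', Or.inl h'⟩
            · exact ⟨Or.inl h'', Or.inr h'⟩
          simp only [n, indicator_of_mem hmem, indicator_of_mem (hsub e t hmem)]
          linarith [hω e]
        · exact hωn e t
      · have hall : ∀ v, t < h v := fun v => by
          by_contra hv
          exact hS' ⟨v, hv⟩
        refine hsingle j ⟨ht.1, (hall _).trans_le (hsrc j).2⟩ fun hc => ?_
        exact absurd (lt_min (hall (Γ.src j)) (hall (Γ.tgt j))) (not_lt.2 hc.1)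
    · have hall : ∀ v, h v ≤ t := fun v => by
        by_contra hv
        exact hS ⟨v, not_le.1 hv⟩
      refine hsingle i ⟨(hsrc i).1.trans (hall _), ht.2⟩ fun hc => ?_
      exact absurd (max_le (hall (Γ.src i)) (hall (Γ.tgt i))) (not_le.2 hc.2)
  have := integral_mono ((integrable_indicator_Ico (lo j) (hi i)).const_mul k)
    (integrable_finsetSum _ fun e _ => (hnint e).const_mul (ω e)) hkey
  rw [integral_const_mul, integral_indicator_Ico hij,
    integral_finsetSum _ fun e _ => (hnint e).const_mul (ω e)] at this
  simpa only [integral_const_mul, hnval] using this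

end MGraph

/-! ### The Poincaré inequality -/

namespace MGraph

variable {V E : Type*} {Γ : MGraph V E} [Fintype E]

/-- A Poincaré inequality for the functions on a metric graph whose cuts have weight at least
`k`. -/
theorem CutWeightGE.poincare [Nonempty E] {ω : E → ℝ} {k : ℝ} (hcut : Γ.CutWeightGE ω k)
    (hω : ∀ e, 1 ≤ ω e) (hk0 : 0 ≤ k) (hk : k ≤ 2) {L : E → ℝ} (hL : ∀ e, 0 < L e)
    {ρ : E → ℝ → ℝ} (hac : ∀ e, AbsolutelyContinuousOnInterval (ρ e) 0 (L e))
    (hsq : ∀ e, IntervalIntegrable (fun t => deriv (ρ e) t ^ 2) volume 0 (L e))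
    {h : V → ℝ} (hsrc : ∀ e, ρ e 0 = h (Γ.src e)) (htgt : ∀ e, ρ e (L e) = h (Γ.tgt e)) :
    ∃ c : ℝ, (k * Real.pi / ∑ e, ω e ^ 2 * L e) ^ 2 * ∑ e, ∫ t in (0 : ℝ)..(L e), (ρ e t - c) ^ 2
      ≤ ∑ e, ∫ t in (0 : ℝ)..(L e), deriv (ρ e) t ^ 2 := by
  have hcont : ∀ e, ContinuousOn (ρ e) (Icc 0 (L e)) := fun e => by
    simpa [uIcc_of_le (hL e).le] using (hac e).continuousOn
  have hmax : ∀ e, ∃ x ∈ Icc 0 (L e), ∀ t ∈ Icc 0 (L e), ρ e t ≤ ρ e x := fun e =>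
    isCompact_Icc.exists_isMaxOn (nonempty_Icc.2 (hL e).le) (hcont e)
  have hmin : ∀ e, ∃ x ∈ Icc 0 (L e), ∀ t ∈ Icc 0 (L e), ρ e x ≤ ρ e t := fun e =>
    isCompact_Icc.exists_isMinOn (nonempty_Icc.2 (hL e).le) (hcont e)
  choose x hx hxmax using hmax
  choose y hy hymin using hmin
  obtain ⟨i, hi⟩ := Finite.exists_max fun e => ρ e (x e)
  obtain ⟨j, hj⟩ := Finite.exists_min fun e => ρ e (y e)
  -- Midpoint and half-width of the global range, so that the half-circle profile is supported
  -- exactly on it.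
  set c := (ρ i (x i) + ρ j (y j)) / 2 with hc
  set A := (ρ i (x i) - ρ j (y j)) / 2 with hA
  have hle : ρ j (y j) ≤ ρ i (x i) := (hj i).trans (hymin i _ (hx i))
  have hA0 : 0 ≤ A := by linarith
  have hrange : ∀ e, ∀ t ∈ Icc 0 (L e), |ρ e t - c| ≤ A := fun e t ht => by
    have h1 := (hxmax e t ht).trans (hi e)
    have h2 := (hj e).trans (hymin e t ht)
    rw [abs_le]
    constructor <;> linarith
  let H : ℝ → ℝ := fun t => ∫ s in c..t, semicircle c A s
  have hmono : Monotone H := monotone_of_deriv_nonneg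
    (fun t => (hasDerivAt_integral_semicircle c A t).differentiableAt) fun t => by
      rw [(hasDerivAt_integral_semicircle c A t).deriv]
      exact Real.sqrt_nonneg _
  have hHosc : H (ρ i (x i)) - H (ρ j (y j)) = Real.pi * A ^ 2 / 2 := by
    simp only [H]
    rw [intervalIntegral.integral_interval_sub_left
      ((continuous_semicircle c A).intervalIntegrable _ _)
      ((continuous_semicircle c A).intervalIntegrable _ _), ← integral_semicircle (c := c) hA0]
    congr 1 <;> linarith
  have hco := hcut.coarea hω hk0 hk (fun v => H (h v)) (fun e => H (ρ e (y e)))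
    (fun e => H (ρ e (x e)))
    (fun e => ⟨hmono (hsrc e ▸ hymin e 0 (left_mem_Icc.2 (hL e).le)),
      hmono (hsrc e ▸ hxmax e 0 (left_mem_Icc.2 (hL e).le))⟩)
    (fun e => ⟨hmono (htgt e ▸ hymin e _ (right_mem_Icc.2 (hL e).le)),
      hmono (htgt e ▸ hxmax e _ (right_mem_Icc.2 (hL e).le))⟩) i j
  rw [hHosc] at hco
  have hWpos : 0 < ∑ e, ω e ^ 2 * L e := Finset.sum_pos (fun e _ =>
    mul_pos (pow_pos (zero_lt_one.trans_le (hω e)) 2) (hL e)) Finset.univ_nonempty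
  set W := ∑ e, ω e ^ 2 * L e with hW
  set s := k * Real.pi / W with hs
  have hs0 : 0 ≤ s := by positivity
  have hsW : s * W = k * Real.pi := div_mul_cancel₀ _ hWpos.ne'
  refine ⟨c, ?_⟩
  have hedge : ∀ e, 2 * s * (ω e * (2 * (H (ρ e (x e)) - H (ρ e (y e)))
      - |H (h (Γ.src e)) - H (h (Γ.tgt e))|)) - s ^ 2 * A ^ 2 * (ω e ^ 2 * L e)
      + s ^ 2 * ∫ t in (0 : ℝ)..(L e), (ρ e t - c) ^ 2
      ≤ ∫ t in (0 : ℝ)..(L e), deriv (ρ e) t ^ 2 := by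
    intro e
    have hcal := (hac e).calibration_le_integral_sq_deriv (hsq e)
      (lipschitzWith_integral_semicircle c A) (hasDerivAt_integral_semicircle c A)
      (continuous_semicircle c A) (fun t => Real.sqrt_nonneg _)
      (mul_nonneg hs0 (zero_le_one.trans (hω e))) (hx e) (hy e)
    have hint : ∫ t in (0 : ℝ)..(L e), semicircle c A (ρ e t) ^ 2
        = A ^ 2 * L e - ∫ t in (0 : ℝ)..(L e), (ρ e t - c) ^ 2 := by
      have hci : IntervalIntegrable (fun t => (ρ e t - c) ^ 2) volume 0 (L e) :=
        (((hac e).continuousOn.sub continuousOn_const).pow 2).intervalIntegrable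
      rw [intervalIntegral.integral_congr (g := fun t => A ^ 2 - (ρ e t - c) ^ 2),
        intervalIntegral.integral_sub (by simp) hci]
      · simp [mul_comm]
      · intro t ht
        rw [uIcc_of_le (hL e).le] at ht
        exact semicircle_sq (hrange e t ht)
    rw [hint, hsrc, htgt] at hcal
    have hI : 0 ≤ ∫ t in (0 : ℝ)..(L e), (ρ e t - c) ^ 2 :=
      intervalIntegral.integral_nonneg (hL e).le fun t _ => sq_nonneg _
    have hω2 : 1 ≤ ω e ^ 2 := one_le_pow₀ (hω e)
    -- The calibration yields the factor `s² ω²` before the last integral; it is lowered to `s²` by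
    -- `ω ≥ 1`.
    have := mul_nonneg (mul_nonneg (sq_nonneg s) (sub_nonneg.2 hω2)) hI
    simp only [H]
    nlinarith
  have hsum := Finset.sum_le_sum fun e (_ : e ∈ Finset.univ) => hedge e
  rw [Finset.sum_add_distrib, Finset.sum_sub_distrib, ← Finset.mul_sum, ← Finset.mul_sum,
    ← Finset.mul_sum, ← hW] at hsum
  -- The choice `s = kπ / W` makes the coarea gain `2s · kπA²/2` cancel the loss `s² A² W`, leaving
  -- only `s² ∑ ∫ (ρ - c)²`.
  have h3 : s ^ 2 * A ^ 2 * W = s * A ^ 2 * (k * Real.pi) := by rw [← hsW]; ring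
  have h4 := mul_le_mul_of_nonneg_left hco (mul_nonneg zero_le_two hs0)
  nlinarith

end MGraph

/-! ### Regularity of `H¹` functions and of their densities -/

theorem sq_integral_le_mul_integral_sq {f : ℝ → ℝ} {a b : ℝ} (hab : a ≤ b)
    (hf : IntervalIntegrable f volume a b) (hf2 : IntervalIntegrable (fun t => f t ^ 2) volume a b) :
    (∫ t in a..b, f t) ^ 2 ≤ (b - a) * ∫ t in a..b, f t ^ 2 := by
  rcases hab.eq_or_lt with rfl | hlt
  · simp
  set m := (∫ t in a..b, f t) / (b - a) with hm
  have h0 : 0 ≤ ∫ t in a..b, (f t - m) ^ 2 :=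
    intervalIntegral.integral_nonneg hab fun t _ => sq_nonneg _
  have h1 : ∫ t in a..b, (f t - m) ^ 2
      = (∫ t in a..b, f t ^ 2) - 2 * m * (∫ t in a..b, f t) + m ^ 2 * (b - a) := by
    rw [intervalIntegral.integral_congr (g := fun t => f t ^ 2 - 2 * m * f t + m ^ 2)
      (fun t _ => by ring), intervalIntegral.integral_add (hf2.sub (hf.const_mul _)) (by simp),
      intervalIntegral.integral_sub hf2 (hf.const_mul _), intervalIntegral.integral_const_mul]
    simp [mul_comm]
  have hba : 0 < b - a := sub_pos.2 hlt
  have h2 : (∫ t in a..b, f t) = m * (b - a) := (div_mul_cancel₀ _ hba.ne').symm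
  rw [h1] at h0
  rw [h2] at h0 ⊢
  nlinarith [mul_nonneg hba.le h0]

theorem AbsolutelyContinuousOnInterval.congr {f g : ℝ → ℝ} {a b : ℝ}
    (hf : AbsolutelyContinuousOnInterval f a b) (h : ∀ x ∈ uIcc a b, f x = g x) :
    AbsolutelyContinuousOnInterval g a b := by
  refine Tendsto.congr' ?_ hf
  rw [EventuallyEq, eventually_inf_principal]
  refine Eventually.of_forall fun I hI => Finset.sum_congr rfl fun i hi => ?_
  rw [h _ (hI.1 i hi).1, h _ (hI.1 i hi).2]

namespace MGraph

variable {V E : Type*} {Γ : MGraph V E} {L : E → ℝ}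

namespace H1

theorem intervalIntegrable_norm_wderiv_sq (u : Γ.H1 L) (e : E) (hL : 0 ≤ L e) :
    IntervalIntegrable (fun t => ‖u.wderiv e t‖ ^ 2) volume 0 (L e) :=
  (intervalIntegrable_iff_integrableOn_Ioc_of_le hL).2
    ((memLp_two_iff_integrable_sq_norm (u.memLp_wderiv e).1).1 (u.memLp_wderiv e))

theorem intervalIntegrable_wderiv (u : Γ.H1 L) (e : E) (hL : 0 ≤ L e) :
    IntervalIntegrable (u.wderiv e) volume 0 (L e) :=
  (intervalIntegrable_iff_integrableOn_Ioc_of_le hL).2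
    ((u.memLp_wderiv e).integrable one_le_two)

theorem continuousOn_toFun (u : Γ.H1 L) (e : E) (hL : 0 ≤ L e) :
    ContinuousOn (u.toFun e) (Icc 0 (L e)) := by
  have h : ContinuousOn (fun x => u.toFun e 0 + ∫ t in (0 : ℝ)..x, u.wderiv e t) (Icc 0 (L e)) := by
    refine continuousOn_const.add ?_
    have := intervalIntegral.continuousOn_primitive_interval
      (f := u.wderiv e) (μ := volume) (a := 0) (b := L e)
      ((intervalIntegrable_iff' (μ := volume)).1 (u.intervalIntegrable_wderiv e hL))
    rwa [uIcc_of_le hL] at this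
  exact h.congr (u.eq_primitive e)

/-- The squared modulus of a function of `H¹`, in a form that is constructed as a primitive also
outside of the edges. -/
noncomputable def density (u : Γ.H1 L) (e : E) (x : ℝ) : ℝ :=
  Complex.normSq (u.toFun e 0 + ∫ t in (0 : ℝ)..x, u.wderiv e t)

theorem density_eq (u : Γ.H1 L) (e : E) {x : ℝ} (hx : x ∈ Icc 0 (L e)) :
    u.density e x = ‖u.toFun e x‖ ^ 2 := by
  rw [density, ← u.eq_primitive e x hx, Complex.normSq_eq_norm_sq]

theorem absolutelyContinuousOnInterval_const_add_integral {f : ℝ → ℝ} {b : ℝ} (c : ℝ)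
    (hf : IntervalIntegrable f volume 0 b) :
    AbsolutelyContinuousOnInterval (fun x => c + ∫ t in (0 : ℝ)..x, f t) 0 b :=
  ((LipschitzWith.const (α := ℝ) c).lipschitzOnWith.absolutelyContinuousOnInterval).add
    (hf.absolutelyContinuousOnInterval_intervalIntegral left_mem_uIcc)

theorem absolutelyContinuousOnInterval_density (u : Γ.H1 L) (e : E) (hL : 0 ≤ L e) :
    AbsolutelyContinuousOnInterval (u.density e) 0 (L e) := by
  have hi := u.intervalIntegrable_wderiv e hL
  have hre : IntervalIntegrable (fun t => (u.wderiv e t).re) volume 0 (L e) :=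
    ⟨hi.1.re, hi.2.re⟩
  have him : IntervalIntegrable (fun t => (u.wderiv e t).im) volume 0 (L e) :=
    ⟨hi.1.im, hi.2.im⟩
  have h1 := absolutelyContinuousOnInterval_const_add_integral (u.toFun e 0).re hre
  have h2 := absolutelyContinuousOnInterval_const_add_integral (u.toFun e 0).im him
  have h3 := (h1.mul h1).add (h2.mul h2)
  have hint : ∀ x ∈ uIcc 0 (L e), IntervalIntegrable (u.wderiv e) volume 0 x := fun x hx =>
    hi.mono_set (uIcc_subset_uIcc_left hx)
  refine h3.congr fun x hx => ?_
  have e1 := Complex.reCLM.intervalIntegral_comp_comm (hint x hx)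
  have e2 := Complex.imCLM.intervalIntegral_comp_comm (hint x hx)
  simp only [Complex.reCLM_apply, Complex.imCLM_apply] at e1 e2
  simp only [Pi.add_apply, Pi.mul_apply, density, Complex.normSq_apply, Complex.add_re,
    Complex.add_im, e1, e2]

/-- Cauchy–Schwarz in `(|u|²)' = 2 Re (ū u')`. It passes from a complex function to its real
density, the function to which the Poincaré inequality applies. -/
theorem ae_sq_deriv_density_le (u : Γ.H1 L) (e : E) (hL : 0 ≤ L e) :
    ∀ᵐ t, t ∈ uIcc 0 (L e) → deriv (u.density e) t ^ 2 ≤ 4 * u.density e t * ‖u.wderiv e t‖ ^ 2 := by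
  filter_upwards [(u.intervalIntegrable_wderiv e hL).ae_hasDerivAt_integral] with t ht hmem
  have h1 := (ht hmem 0 left_mem_uIcc).const_add (u.toFun e 0)
  have h2 : deriv (u.density e) t = 2 * inner ℝ (u.toFun e 0 + ∫ t in (0 : ℝ)..t, u.wderiv e t)
      (u.wderiv e t) := by
    rw [← h1.norm_sq.deriv]
    congr 1
    ext x
    rw [density, Complex.normSq_eq_norm_sq]
  rw [h2, density, Complex.normSq_eq_norm_sq, mul_pow, ← sq_abs (inner ℝ _ _)]
  have := abs_real_inner_le_norm (u.toFun e 0 + ∫ t in (0 : ℝ)..t, u.wderiv e t) (u.wderiv e t)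
  have := pow_le_pow_left₀ (abs_nonneg _) this 2
  rw [mul_pow] at this
  linarith

theorem intervalIntegrable_sq_deriv_density (u : Γ.H1 L) (e : E) (hL : 0 ≤ L e) {B : ℝ}
    (hB : ∀ x ∈ Icc 0 (L e), u.density e x ≤ B) :
    IntervalIntegrable (fun t => deriv (u.density e) t ^ 2) volume 0 (L e) := by
  refine ((u.intervalIntegrable_norm_wderiv_sq e hL).const_mul (4 * B)).mono_fun
    ((measurable_deriv _).pow_const 2).aestronglyMeasurable ?_
  rw [EventuallyLE, ae_restrict_iff' measurableSet_uIoc]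
  filter_upwards [u.ae_sq_deriv_density_le e hL] with t ht hmem
  have hmem' := uIoc_subset_uIcc hmem
  have := ht hmem'
  rw [uIcc_of_le hL] at hmem'
  rw [Real.norm_of_nonneg (sq_nonneg _)]
  refine (this.trans ?_).trans (le_abs_self _)
  gcongr
  exact hB t hmem'

theorem integral_sq_deriv_density_le (u : Γ.H1 L) (e : E) (hL : 0 ≤ L e) {B : ℝ}
    (hB : ∀ x ∈ Icc 0 (L e), u.density e x ≤ B) :
    ∫ t in (0 : ℝ)..(L e), deriv (u.density e) t ^ 2
      ≤ 4 * B * ∫ t in (0 : ℝ)..(L e), ‖u.wderiv e t‖ ^ 2 := by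
  rw [← intervalIntegral.integral_const_mul]
  refine intervalIntegral.integral_mono_ae_restrict hL
    (u.intervalIntegrable_sq_deriv_density e hL hB)
    ((u.intervalIntegrable_norm_wderiv_sq e hL).const_mul (4 * B)) ?_
  rw [EventuallyLE, ae_restrict_iff' measurableSet_Icc]
  filter_upwards [u.ae_sq_deriv_density_le e hL] with t ht hmem
  refine (ht (by rwa [uIcc_of_le hL])).trans ?_
  gcongr
  exact hB t hmem

/-- A Sobolev inequality on one edge. -/
theorem norm_sub_sq_le (u : Γ.H1 L) (e : E) (hL : 0 < L e) (c : ℂ) {x : ℝ} (hx : x ∈ Icc 0 (L e)) :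
    ‖u.toFun e x - c‖ ^ 2 ≤ 2 / L e * (∫ t in (0 : ℝ)..(L e), ‖u.toFun e t - c‖ ^ 2)
      + 2 * L e * ∫ t in (0 : ℝ)..(L e), ‖u.wderiv e t‖ ^ 2 := by
  have hi := u.intervalIntegrable_wderiv e hL.le
  set D := ∫ t in (0 : ℝ)..(L e), ‖u.wderiv e t‖ ^ 2 with hD
  have hcs : (∫ t in (0 : ℝ)..(L e), ‖u.wderiv e t‖) ^ 2 ≤ L e * D := by
    simpa using sq_integral_le_mul_integral_sq hL.le hi.norm
      (u.intervalIntegrable_norm_wderiv_sq e hL.le)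
  have h1 : ∀ y ∈ Icc 0 (L e), ‖u.toFun e x - c‖ ^ 2 ≤ 2 * ‖u.toFun e y - c‖ ^ 2 + 2 * (L e * D) := by
    intro y hy
    have hsub : ∀ z ∈ Icc 0 (L e), IntervalIntegrable (u.wderiv e) volume 0 z := fun z hz =>
      hi.mono_set (uIcc_subset_uIcc_left (by rwa [uIcc_of_le hL.le]))
    have hdiff : u.toFun e x - u.toFun e y = ∫ t in y..x, u.wderiv e t := by
      rw [u.eq_primitive e x hx, u.eq_primitive e y hy,
        ← intervalIntegral.integral_interval_sub_left (hsub x hx) (hsub y hy)]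
      ring
    have hle : ‖u.toFun e x - u.toFun e y‖ ≤ ∫ t in (0 : ℝ)..(L e), ‖u.wderiv e t‖ := by
      rw [hdiff, intervalIntegral.integral_of_le hL.le]
      refine (intervalIntegral.norm_integral_le_integral_norm_uIoc).trans ?_
      refine setIntegral_mono_set ((intervalIntegrable_iff_integrableOn_Ioc_of_le hL.le).1 hi).norm
        (ae_of_all _ fun t => norm_nonneg _) (LE.le.eventuallyLE ?_)
      exact Ioc_subset_Ioc (by simp [hx.1, hy.1]) (by simp [hx.2, hy.2])
    have h2 : ‖u.toFun e x - c‖ ≤ ‖u.toFun e y - c‖ + ∫ t in (0 : ℝ)..(L e), ‖u.wderiv e t‖ := by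
      calc ‖u.toFun e x - c‖ = ‖(u.toFun e y - c) + (u.toFun e x - u.toFun e y)‖ := by congr 1; ring
        _ ≤ _ := (norm_add_le _ _).trans (by gcongr)
    have h3 := pow_le_pow_left₀ (norm_nonneg _) h2 2
    nlinarith [sq_nonneg (‖u.toFun e y - c‖ - ∫ t in (0 : ℝ)..(L e), ‖u.wderiv e t‖)]
  have hci : IntervalIntegrable (fun t => ‖u.toFun e t - c‖ ^ 2) volume 0 (L e) := by
    refine ContinuousOn.intervalIntegrable ?_
    rw [uIcc_of_le hL.le]
    exact ((u.continuousOn_toFun e hL.le).sub continuousOn_const).norm.pow 2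
  -- The pointwise comparison of `x` with `y` is averaged over `y`.
  have h4 := intervalIntegral.integral_mono_on hL.le (by simp)
    ((hci.const_mul 2).add (intervalIntegrable_const (c := 2 * (L e * D)))) h1
  rw [intervalIntegral.integral_add (hci.const_mul 2) (by simp),
    intervalIntegral.integral_const_mul, intervalIntegral.integral_const,
    intervalIntegral.integral_const] at h4
  simp only [sub_zero, smul_eq_mul] at h4
  refine le_of_mul_le_mul_left (h4.trans (le_of_eq ?_)) hL
  field_simp

end H1
end MGraph

/-! ### Local minimality of the constant for small mass -/

namespace MGraph

variable {V E : Type*} {Γ : MGraph V E} [Fintype E] {L : E → ℝ}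

/-- `H¹`-closeness becomes uniform closeness, with a crude constant that serves all edges at once.
-/
theorem H1.norm_sub_const_sq_le_dist_sq (w : Γ.H1 L) (hL : ∀ e, 0 < L e) (c : ℂ) (e : E) {x : ℝ}
    (hx : x ∈ Icc 0 (L e)) :
    ‖w.toFun e x - c‖ ^ 2 ≤ (∑ e, (2 / L e + 2 * L e)) * w.dist (H1.const Γ L c) ^ 2 := by
  have hM0 : ∀ e, 0 ≤ ∫ t in (0 : ℝ)..(L e), ‖w.toFun e t - c‖ ^ 2 := fun e =>
    intervalIntegral.integral_nonneg (hL e).le fun t _ => sq_nonneg _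
  have hD0 : ∀ e, 0 ≤ ∫ t in (0 : ℝ)..(L e), ‖w.wderiv e t‖ ^ 2 := fun e =>
    intervalIntegral.integral_nonneg (hL e).le fun t _ => sq_nonneg _
  have hd : w.dist (H1.const Γ L c) ^ 2 = (∑ e, ∫ t in (0 : ℝ)..(L e), ‖w.toFun e t - c‖ ^ 2)
      + ∑ e, ∫ t in (0 : ℝ)..(L e), ‖w.wderiv e t‖ ^ 2 := by
    rw [H1.dist, Real.sq_sqrt]
    · simp [H1.const]
    · exact add_nonneg (Finset.sum_nonneg fun e _ => hM0 e)
        (Finset.sum_nonneg fun e _ => intervalIntegral.integral_nonneg (hL e).le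
          fun t _ => sq_nonneg _)
  have h1 := Finset.single_le_sum (fun e _ => hM0 e) (Finset.mem_univ e)
  have h2 := Finset.single_le_sum (fun e _ => hD0 e) (Finset.mem_univ e)
  have hC0 : ∀ e, 0 ≤ 2 / L e + 2 * L e := fun e => by have := hL e; positivity
  have h3 := Finset.single_le_sum (fun e _ => hC0 e) (Finset.mem_univ e)
  have hLe := hL e
  calc ‖w.toFun e x - c‖ ^ 2 ≤ 2 / L e * (∫ t in (0 : ℝ)..(L e), ‖w.toFun e t - c‖ ^ 2)
      + 2 * L e * ∫ t in (0 : ℝ)..(L e), ‖w.wderiv e t‖ ^ 2 := w.norm_sub_sq_le e hLe c hx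
    _ ≤ 2 / L e * w.dist (H1.const Γ L c) ^ 2 + 2 * L e * w.dist (H1.const Γ L c) ^ 2 := by
      have := Finset.sum_nonneg fun e (_ : e ∈ Finset.univ) => hM0 e
      have := Finset.sum_nonneg fun e (_ : e ∈ Finset.univ) => hD0 e
      gcongr <;> rw [hd] <;> linarith
    _ = (2 / L e + 2 * L e) * w.dist (H1.const Γ L c) ^ 2 := by ring
    _ ≤ _ := by gcongr

theorem mass_kappa (Γ : MGraph V E) {μ : ℝ} (hμ : 0 ≤ μ) (hL : 0 < ∑ e, L e) :
    (Γ.kappa L μ).mass = μ := by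
  simp only [H1.mass, kappa, H1.const, Complex.norm_real, Real.norm_eq_abs, sq_abs,
    intervalIntegral.integral_const, sub_zero, smul_eq_mul, Real.sq_sqrt (div_nonneg hμ hL.le)]
  rw [← Finset.sum_mul, mul_div_cancel₀ _ hL.ne']

theorem energy_six (u : Γ.H1 L) : u.energy 6 =
    1 / 2 * (∑ e, ∫ x in (0 : ℝ)..(L e), ‖u.wderiv e x‖ ^ 2)
      - 1 / 6 * ∑ e, ∫ x in (0 : ℝ)..(L e), (‖u.toFun e x‖ ^ 2) ^ 3 := by
  simp only [H1.energy, ← pow_mul]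
  norm_num

theorem energy_six_kappa (Γ : MGraph V E) {μ : ℝ} (hμ : 0 ≤ μ) (hL : 0 < ∑ e, L e) :
    (Γ.kappa L μ).energy 6 = - (1 / 6 * ((μ / ∑ e, L e) ^ 3 * ∑ e, L e)) := by
  simp only [energy_six, kappa, H1.const, Complex.norm_real, Real.norm_eq_abs, sq_abs,
    intervalIntegral.integral_const, sub_zero, smul_eq_mul, Real.sq_sqrt (div_nonneg hμ hL.le)]
  simp [← Finset.sum_mul, mul_comm]

theorem abs_norm_sq_sub_sq_le {w : ℂ} {r η : ℝ} (hr : 0 ≤ r) (hη : η ≤ 1)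
    (h : ‖w - r‖ ≤ η) : |‖w‖ ^ 2 - r ^ 2| ≤ η * (1 + 2 * r) := by
  have h1 : |‖w‖ - r| ≤ η := by
    have := abs_norm_sub_norm_le w (r : ℂ)
    rw [Complex.norm_real, Real.norm_of_nonneg hr] at this
    exact this.trans h
  have hη0 : 0 ≤ η := (abs_nonneg _).trans h1
  have h2 : |‖w‖ + r| ≤ 1 + 2 * r := by
    rw [abs_of_nonneg (by positivity)]
    linarith [(abs_le.1 h1).2]
  rw [show ‖w‖ ^ 2 - r ^ 2 = (‖w‖ - r) * (‖w‖ + r) by ring, abs_mul]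
  gcongr

/-- If every cut has weight at least `k`, the constant function of small enough mass is a local
minimizer of the energy. -/
theorem CutWeightGE.isLocalMinimizer_kappa [Nonempty E] {ω : E → ℝ} {k : ℝ}
    (hcut : Γ.CutWeightGE ω k) (hω : ∀ e, 1 ≤ ω e) (hk0 : 0 ≤ k) (hk : k ≤ 2)
    (hL : ∀ e, 0 < L e) {μ : ℝ} (hμ : 0 ≤ μ)
    (hμk : 2 * (μ / ∑ e, L e) < k * Real.pi / ∑ e, ω e ^ 2 * L e) :
    (Γ.kappa L μ).IsLocalMinimizer 6 := by
  have hLpos : 0 < ∑ e, L e := Finset.sum_pos (fun e _ => hL e) Finset.univ_nonempty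
  set q := μ / ∑ e, L e with hq
  have hq0 : 0 ≤ q := div_nonneg hμ hLpos.le
  set s := k * Real.pi / ∑ e, ω e ^ 2 * L e with hs
  -- The whole gap in the mass condition is spent on `δ`, so that `s = 2 (q + δ)` and the final
  -- estimate closes without loss.
  set δ := s / 2 - q with hδ
  have hδ0 : 0 < δ := by linarith
  set r := √q with hr
  have hr0 : 0 ≤ r := Real.sqrt_nonneg _
  have hrq : r ^ 2 = q := Real.sq_sqrt hq0
  set C := ∑ e, (2 / L e + 2 * L e) with hC
  have hC0 : 0 < C := Finset.sum_pos (fun e _ => by have := hL e; positivity) Finset.univ_nonempty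
  set η := min 1 (δ / (1 + 2 * r)) with hη
  have hη0 : 0 < η := by positivity
  refine ⟨η / √C, by positivity, fun w hmass hdist => ?_⟩
  have hclose : ∀ e, ∀ x ∈ Icc 0 (L e), |‖w.toFun e x‖ ^ 2 - q| ≤ δ := by
    intro e x hx
    have h1 := w.norm_sub_const_sq_le_dist_sq hL r e hx
    have h2 : w.dist (H1.const Γ L r) ^ 2 ≤ (η / √C) ^ 2 :=
      pow_le_pow_left₀ (Real.sqrt_nonneg _) hdist.le 2
    rw [div_pow, Real.sq_sqrt hC0.le] at h2
    have h3 : ‖w.toFun e x - r‖ ^ 2 ≤ η ^ 2 := by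
      refine h1.trans ((mul_le_mul_of_nonneg_left h2 hC0.le).trans (le_of_eq ?_))
      field_simp
    have h4 := abs_norm_sq_sub_sq_le hr0 (min_le_left _ _) (le_of_sq_le_sq h3 hη0.le)
    rw [hrq] at h4
    refine h4.trans ((mul_le_mul_of_nonneg_right (min_le_right _ _) (by positivity)).trans ?_)
    rw [div_mul_cancel₀ _ (by positivity)]
  have hdens : ∀ e, ∀ x ∈ Icc 0 (L e), w.density e x ≤ q + δ := fun e x hx => by
    rw [w.density_eq e hx]
    linarith [(abs_le.1 (hclose e x hx)).2]
  obtain ⟨v, hv⟩ := w.continuous_at_vertices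
  obtain ⟨c, hpoin⟩ := hcut.poincare hω hk0 hk hL (ρ := w.density)
    (fun e => w.absolutelyContinuousOnInterval_density e (hL e).le)
    (fun e => w.intervalIntegrable_sq_deriv_density e (hL e).le (hdens e))
    (h := fun x => ‖v x‖ ^ 2)
    (fun e => by rw [w.density_eq e (left_mem_Icc.2 (hL e).le), (hv e).1])
    (fun e => by rw [w.density_eq e (right_mem_Icc.2 (hL e).le), (hv e).2])
  have hder := Finset.sum_le_sum fun e (_ : e ∈ Finset.univ) =>
    w.integral_sq_deriv_density_le e (hL e).le (hdens e)
  rw [← Finset.mul_sum] at hder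
  let R1 : E → ℝ := fun e => ∫ t in (0 : ℝ)..(L e), (‖w.toFun e t‖ ^ 2 - q)
  let R2 : E → ℝ := fun e => ∫ t in (0 : ℝ)..(L e), (‖w.toFun e t‖ ^ 2 - q) ^ 2
  have hcont : ∀ e, ContinuousOn (fun t => ‖w.toFun e t‖ ^ 2) (uIcc 0 (L e)) := fun e => by
    rw [uIcc_of_le (hL e).le]
    exact (w.continuousOn_toFun e (hL e).le).norm.pow 2
  have hi1 : ∀ e, IntervalIntegrable (fun t => ‖w.toFun e t‖ ^ 2 - q) volume 0 (L e) := fun e =>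
    ((hcont e).sub continuousOn_const).intervalIntegrable
  have hi2 : ∀ e, IntervalIntegrable (fun t => (‖w.toFun e t‖ ^ 2 - q) ^ 2) volume 0 (L e) :=
    fun e => (((hcont e).sub continuousOn_const).pow 2).intervalIntegrable
  have hm : ∀ e, ∫ t in (0 : ℝ)..(L e), ‖w.toFun e t‖ ^ 2 = R1 e + q * L e := fun e => by
    simp only [R1]
    rw [intervalIntegral.integral_sub (hcont e).intervalIntegrable (by simp)]
    simp [mul_comm]
  have hc2 : ∀ e, ∫ t in (0 : ℝ)..(L e), (w.density e t - c) ^ 2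
      = R2 e + 2 * (q - c) * R1 e + (q - c) ^ 2 * L e := fun e => by
    rw [intervalIntegral.integral_congr (g := fun t => (‖w.toFun e t‖ ^ 2 - q) ^ 2
      + 2 * (q - c) * (‖w.toFun e t‖ ^ 2 - q) + (q - c) ^ 2),
      intervalIntegral.integral_add ((hi2 e).add ((hi1 e).const_mul _)) (by simp),
      intervalIntegral.integral_add (hi2 e) ((hi1 e).const_mul _),
      intervalIntegral.integral_const_mul]
    · simp [R1, R2, mul_comm]
    · intro t ht
      rw [uIcc_of_le (hL e).le] at ht
      simp only [w.density_eq e ht]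
      ring
  -- With `z = |w|² - q ≤ δ`, the cubic term of `(q + z)³` is absorbed by `z³ ≤ δ z² ≤ 3δ z²`. The
  -- linear term will vanish after summation, because the masses agree.
  have h3 : ∀ e, ∫ t in (0 : ℝ)..(L e), (‖w.toFun e t‖ ^ 2) ^ 3
      ≤ 3 * (q + δ) * R2 e + 3 * q ^ 2 * R1 e + q ^ 3 * L e := fun e => by
    have hmono := intervalIntegral.integral_mono_on (hL e).le
      ((hcont e).pow 3).intervalIntegrable
      ((((hi2 e).const_mul (3 * (q + δ))).add ((hi1 e).const_mul (3 * q ^ 2))).add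
        (intervalIntegrable_const (c := q ^ 3))) (fun t ht => by
          have h1 := (abs_le.1 (hclose e t ht)).2
          change (‖w.toFun e t‖ ^ 2) ^ 3 ≤ 3 * (q + δ) * (‖w.toFun e t‖ ^ 2 - q) ^ 2
            + 3 * q ^ 2 * (‖w.toFun e t‖ ^ 2 - q) + q ^ 3
          set z := ‖w.toFun e t‖ ^ 2 - q with hz
          have h2 : ‖w.toFun e t‖ ^ 2 = z + q := by rw [hz]; ring
          have h5 : z * z ^ 2 ≤ δ * z ^ 2 := mul_le_mul_of_nonneg_right h1 (sq_nonneg z)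
          have h6 : 0 ≤ δ * z ^ 2 := by positivity
          rw [h2]
          nlinarith)
    rw [intervalIntegral.integral_add (((hi2 e).const_mul _).add ((hi1 e).const_mul _)) (by simp),
      intervalIntegral.integral_add ((hi2 e).const_mul _) ((hi1 e).const_mul _),
      intervalIntegral.integral_const_mul, intervalIntegral.integral_const_mul] at hmono
    simpa [R1, R2, mul_comm] using hmono
  have hsum3 := Finset.sum_le_sum fun e (_ : e ∈ Finset.univ) => h3 e
  have hqL : q * ∑ e, L e = μ := div_mul_cancel₀ _ hLpos.ne'
  rw [mass_kappa Γ hμ hLpos, H1.mass] at hmass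
  simp only [hm, hc2, Finset.sum_add_distrib, ← Finset.mul_sum] at hmass hpoin hsum3
  have hR1 : ∑ e, R1 e = 0 := by linarith
  rw [hR1] at hpoin hsum3
  rw [energy_six_kappa Γ hμ hLpos, energy_six, ← hq]
  have hR2 : 0 ≤ ∑ e, R2 e := Finset.sum_nonneg fun e _ =>
    intervalIntegral.integral_nonneg (hL e).le fun t _ => sq_nonneg _
  set D := ∑ e, ∫ t in (0 : ℝ)..(L e), ‖w.wderiv e t‖ ^ 2
  have hs2 : s = 2 * (q + δ) := by rw [hδ]; ring
  have hqδ : 0 < q + δ := by positivity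
  have hfin : (q + δ) * ∑ e, R2 e ≤ D := by
    have h7 := hpoin.trans hder
    rw [← hs, hs2] at h7
    -- As `q` is the mean of the density, replacing `c` by `q` only decreases the left side of the
    -- Poincaré inequality.
    have h8 : 0 ≤ (q - c) ^ 2 * ∑ e, L e := by positivity
    refine le_of_mul_le_mul_left (a := 4 * (q + δ)) ?_ (by positivity)
    nlinarith [mul_nonneg (sq_nonneg (q + δ)) h8]
  linarith

end MGraph

/-! ### The second variation at a constant local minimizer -/

namespace MGraph

variable {V E : Type*} {Γ : MGraph V E} {L : E → ℝ}

/-- A continuously differentiable real function on the graph. -/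
structure TestFunction (Γ : MGraph V E) (L : E → ℝ) where
  /-- the function -/
  toFun : E → ℝ → ℝ
  /-- its derivative -/
  deriv : E → ℝ → ℝ
  /-- its values at the vertices -/
  vertex : V → ℝ
  hasDerivAt : ∀ e x, HasDerivAt (toFun e) (deriv e x) x
  continuous_deriv : ∀ e, Continuous (deriv e)
  apply_zero : ∀ e, toFun e 0 = vertex (Γ.src e)
  apply_length : ∀ e, toFun e (L e) = vertex (Γ.tgt e)

namespace TestFunction

variable (ψ : Γ.TestFunction L)

theorem continuous (e : E) : Continuous (ψ.toFun e) :=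
  continuous_iff_continuousAt.2 fun x => (ψ.hasDerivAt e x).continuousAt

/-- A continuously differentiable function as an element of `H¹`. -/
noncomputable def toH1 : Γ.H1 L where
  toFun := fun e x => (ψ.toFun e x : ℂ)
  wderiv := fun e x => (ψ.deriv e x : ℂ)
  memLp_wderiv := fun e => by
    have hc : Continuous fun x => (ψ.deriv e x : ℂ) :=
      Complex.continuous_ofReal.comp (ψ.continuous_deriv e)
    rw [memLp_two_iff_integrable_sq_norm hc.aestronglyMeasurable]
    exact (hc.norm.pow 2).integrableOn_Ioc
  eq_primitive := fun e x _ => by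
    rw [intervalIntegral.integral_eq_sub_of_hasDerivAt
      (fun t _ => (ψ.hasDerivAt e t).ofReal_comp)
      ((Complex.continuous_ofReal.comp (ψ.continuous_deriv e)).intervalIntegrable _ _)]
    ring
  continuous_at_vertices := ⟨fun v => (ψ.vertex v : ℂ), fun e => by
    rw [ψ.apply_zero, ψ.apply_length]
    exact ⟨rfl, rfl⟩⟩

/-- The function `r √(1 + t ψ)`, where `t ψ > -1`. -/
noncomputable def sqrtPerturb (r t : ℝ) (h : ∀ e x, 0 < 1 + t * ψ.toFun e x) :
    Γ.TestFunction L where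
  toFun := fun e x => r * √(1 + t * ψ.toFun e x)
  deriv := fun e x => r * (t * ψ.deriv e x / (2 * √(1 + t * ψ.toFun e x)))
  vertex := fun v => r * √(1 + t * ψ.vertex v)
  hasDerivAt := fun e x =>
    ((((ψ.hasDerivAt e x).const_mul t).const_add 1).sqrt (h e x).ne').const_mul r
  continuous_deriv := fun e => by
    have := ψ.continuous e
    have := ψ.continuous_deriv e
    refine continuous_const.mul (Continuous.div (by fun_prop) (by fun_prop) fun x => ?_)
    have := Real.sqrt_pos.2 (h e x)
    positivity
  apply_zero := fun e => by rw [ψ.apply_zero]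
  apply_length := fun e => by rw [ψ.apply_length]

variable [Fintype E]

/-- The second variation of the energy at a constant local minimizer is nonnegative. -/
theorem le_of_isLocalMinimizer_kappa [Nonempty E] (hL : ∀ e, 0 < L e) {μ : ℝ} (hμ : 0 < μ)
    (hmin : (Γ.kappa L μ).IsLocalMinimizer 6) (hψ : ∀ e x, |ψ.toFun e x| ≤ 2)
    (hmean : ∑ e, ∫ x in (0 : ℝ)..(L e), ψ.toFun e x = 0) :
    (2 * (μ / ∑ e, L e)) ^ 2 * ∑ e, ∫ x in (0 : ℝ)..(L e), ψ.toFun e x ^ 2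
      ≤ ∑ e, ∫ x in (0 : ℝ)..(L e), ψ.deriv e x ^ 2 := by
  have hLpos : 0 < ∑ e, L e := Finset.sum_pos (fun e _ => hL e) Finset.univ_nonempty
  obtain ⟨ε, hε, hmin⟩ := hmin
  rw [mass_kappa Γ hμ.le hLpos, energy_six_kappa Γ hμ.le hLpos] at hmin
  set q := μ / ∑ e, L e with hq
  have hq0 : 0 < q := div_pos hμ hLpos
  have hqL : q * ∑ e, L e = μ := div_mul_cancel₀ _ hLpos.ne'
  set D := ∑ e, ∫ x in (0 : ℝ)..(L e), ψ.deriv e x ^ 2 with hD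
  set P := ∑ e, ∫ x in (0 : ℝ)..(L e), ψ.toFun e x ^ 2 with hP
  have hD0 : 0 ≤ D := Finset.sum_nonneg fun e _ =>
    intervalIntegral.integral_nonneg (hL e).le fun t _ => sq_nonneg _
  have hc : ∀ e, Continuous (ψ.toFun e) := ψ.continuous
  have hc' : ∀ e, Continuous (ψ.deriv e) := ψ.continuous_deriv
  have hψt : ∀ e x t, 0 < t → 1 - 2 * t ≤ 1 + t * ψ.toFun e x := fun e x t ht => by
    nlinarith [(abs_le.1 (hψ e x)).1]
  -- The competitor `√q √(1 + tψ)` has density `q (1 + tψ)`, hence exactly the mass `μ`, and its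
  -- sixth power is a cubic polynomial in `tψ`. The factor `3 - 2t` comes from `ψ³ ≥ -2ψ²`, the
  -- factor `1 - 2t` from `1 + tψ ≥ 1 - 2t` in the kinetic term. The smallness condition keeps the
  -- competitor within distance `ε` of the constant.
  have key : ∀ t : ℝ, 0 < t → t < 1 / 4 → t ^ 2 * (4 * q * ∑ e, L e + q / 2 * D) < ε ^ 2 →
      (2 * q) ^ 2 * ((3 - 2 * t) * (1 - 2 * t)) * P ≤ 3 * D := by
    intro t ht ht4 hsmall
    have hpos : ∀ e x, 0 < 1 + t * ψ.toFun e x := fun e x => by linarith [hψt e x t ht]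
    set u := ψ.sqrtPerturb (√q) t hpos with hu
    have hderiv : ∀ e x, ‖u.toH1.wderiv e x‖ ^ 2
        ≤ q * t ^ 2 / (4 * (1 - 2 * t)) * ψ.deriv e x ^ 2 := fun e x => by
      simp only [toH1, hu, sqrtPerturb, Complex.norm_real, Real.norm_eq_abs, sq_abs]
      rw [mul_pow, div_pow, mul_pow, mul_pow, Real.sq_sqrt hq0.le, Real.sq_sqrt (hpos e x).le]
      have h2 : 0 < 1 - 2 * t := by linarith
      calc q * (t ^ 2 * ψ.deriv e x ^ 2 / (2 ^ 2 * (1 + t * ψ.toFun e x)))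
          = q * t ^ 2 * ψ.deriv e x ^ 2 / (4 * (1 + t * ψ.toFun e x)) := by ring
        _ ≤ q * t ^ 2 * ψ.deriv e x ^ 2 / (4 * (1 - 2 * t)) :=
          div_le_div_of_nonneg_left (by positivity) (by positivity) (by linarith [hψt e x t ht])
        _ = _ := by ring
    have hval : ∀ e x, ‖u.toH1.toFun e x‖ ^ 2 = q * (1 + t * ψ.toFun e x) := fun e x => by
      simp only [toH1, hu, sqrtPerturb, Complex.norm_real, Real.norm_eq_abs, sq_abs]
      rw [mul_pow, Real.sq_sqrt hq0.le, Real.sq_sqrt (hpos e x).le]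
    have hdiff : ∀ e x, ‖u.toH1.toFun e x - (√q : ℝ)‖ ^ 2 ≤ 4 * q * t ^ 2 := fun e x => by
      simp only [toH1, hu, sqrtPerturb, ← Complex.ofReal_sub, Complex.norm_real, Real.norm_eq_abs,
        sq_abs]
      have h1 := Real.sq_sqrt (hpos e x).le
      have h2 := Real.sqrt_nonneg (1 + t * ψ.toFun e x)
      have h3 := sq_abs (ψ.toFun e x)
      have h4 := pow_le_pow_left₀ (abs_nonneg _) (hψ e x) 2
      set z := √(1 + t * ψ.toFun e x)
      have h5 : (z - 1) ^ 2 * (z + 1) ^ 2 = t ^ 2 * ψ.toFun e x ^ 2 := by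
        rw [← mul_pow, show (z - 1) * (z + 1) = z ^ 2 - 1 by ring, h1]
        ring
      have h6 : (z - 1) ^ 2 ≤ (z - 1) ^ 2 * (z + 1) ^ 2 :=
        le_mul_of_one_le_right (sq_nonneg _) (by nlinarith)
      have h7 : (z - 1) ^ 2 ≤ 4 * t ^ 2 := by nlinarith [sq_nonneg t]
      calc (√q * z - √q) ^ 2 = √q ^ 2 * (z - 1) ^ 2 := by ring
        _ = q * (z - 1) ^ 2 := by rw [Real.sq_sqrt hq0.le]
        _ ≤ 4 * q * t ^ 2 := by nlinarith
    have hcu : ∀ e, Continuous (u.toH1.toFun e) := fun e =>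
      Complex.continuous_ofReal.comp (u.continuous e)
    have hcu' : ∀ e, Continuous (u.toH1.wderiv e) := fun e =>
      Complex.continuous_ofReal.comp (u.continuous_deriv e)
    have hDu : ∑ e, ∫ x in (0 : ℝ)..(L e), ‖u.toH1.wderiv e x‖ ^ 2
        ≤ q * t ^ 2 / (4 * (1 - 2 * t)) * D := by
      rw [hD, Finset.mul_sum]
      refine Finset.sum_le_sum fun e _ => ?_
      rw [← intervalIntegral.integral_const_mul]
      exact intervalIntegral.integral_mono_on (hL e).le
        (((hcu' e).norm.pow 2).intervalIntegrable _ _)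
        ((continuous_const.mul ((hc' e).pow 2)).intervalIntegrable _ _) fun x _ => hderiv e x
    have hMu : ∑ e, ∫ x in (0 : ℝ)..(L e), ‖u.toH1.toFun e x - (√q : ℝ)‖ ^ 2
        ≤ 4 * q * t ^ 2 * ∑ e, L e := by
      rw [Finset.mul_sum]
      refine Finset.sum_le_sum fun e _ => ?_
      have := intervalIntegral.integral_mono_on (hL e).le
        ((((hcu e).sub continuous_const).norm.pow 2).intervalIntegrable _ _)
        (intervalIntegrable_const (μ := volume) (c := 4 * q * t ^ 2)) fun x _ => hdiff e x
      rw [intervalIntegral.integral_const] at this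
      simpa [mul_comm] using this
    have hmass : u.toH1.mass = μ := by
      simp only [H1.mass, hval, intervalIntegral.integral_const_mul]
      rw [← Finset.mul_sum, ← hqL]
      congr 1
      have : ∀ e, ∫ x in (0 : ℝ)..(L e), (1 + t * ψ.toFun e x)
          = L e + t * ∫ x in (0 : ℝ)..(L e), ψ.toFun e x := fun e => by
        have hi : IntervalIntegrable (fun x => t * ψ.toFun e x) volume 0 (L e) :=
          (continuous_const.mul (hc e)).intervalIntegrable _ _
        rw [intervalIntegral.integral_add (intervalIntegrable_const (μ := volume)) hi,
          intervalIntegral.integral_const_mul]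
        simp
      simp only [this, Finset.sum_add_distrib, ← Finset.mul_sum, hmean]
      ring
    have hdist : u.toH1.dist (Γ.kappa L μ) < ε := by
      rw [H1.dist, Real.sqrt_lt' hε]
      simp only [kappa, H1.const, sub_zero, ← hq]
      refine (add_le_add hMu hDu).trans_lt (lt_of_le_of_lt ?_ hsmall)
      have : q * t ^ 2 / (4 * (1 - 2 * t)) ≤ q * t ^ 2 / 2 := by
        gcongr
        linarith
      have := mul_le_mul_of_nonneg_right this hD0
      linarith
    have hen := hmin u.toH1 hmass hdist
    rw [energy_six] at hen
    have h6 : q ^ 3 * (∑ e, L e) + q ^ 3 * (t ^ 2 * (3 - 2 * t)) * P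
        ≤ ∑ e, ∫ x in (0 : ℝ)..(L e), (‖u.toH1.toFun e x‖ ^ 2) ^ 3 := by
      have : ∀ e, q ^ 3 * L e + 3 * q ^ 3 * t * (∫ x in (0 : ℝ)..(L e), ψ.toFun e x)
          + q ^ 3 * (t ^ 2 * (3 - 2 * t)) * (∫ x in (0 : ℝ)..(L e), ψ.toFun e x ^ 2)
          ≤ ∫ x in (0 : ℝ)..(L e), (‖u.toH1.toFun e x‖ ^ 2) ^ 3 := fun e => by
        have hi1 : IntervalIntegrable (fun x => 3 * q ^ 3 * t * ψ.toFun e x) volume 0 (L e) :=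
          (continuous_const.mul (hc e)).intervalIntegrable _ _
        have hi2 : IntervalIntegrable (fun x => q ^ 3 * (t ^ 2 * (3 - 2 * t)) * ψ.toFun e x ^ 2)
            volume 0 (L e) := (continuous_const.mul ((hc e).pow 2)).intervalIntegrable _ _
        have hmono := intervalIntegral.integral_mono_on (hL e).le
          (((intervalIntegrable_const (c := q ^ 3)).add hi1).add hi2)
          ((((hcu e).norm.pow 2).pow 3).intervalIntegrable _ _) (fun x _ => by
            change q ^ 3 + 3 * q ^ 3 * t * ψ.toFun e x
              + q ^ 3 * (t ^ 2 * (3 - 2 * t)) * ψ.toFun e x ^ 2 ≤ (‖u.toH1.toFun e x‖ ^ 2) ^ 3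
            rw [hval]
            have h1 : 0 ≤ ψ.toFun e x + 2 := by linarith [(abs_le.1 (hψ e x)).1]
            have h2 : 0 ≤ q ^ 3 * t ^ 3 * (ψ.toFun e x ^ 2 * (ψ.toFun e x + 2)) := by positivity
            linarith)
        rw [intervalIntegral.integral_add ((intervalIntegrable_const (c := q ^ 3)).add hi1) hi2,
          intervalIntegral.integral_add (by simp) hi1, intervalIntegral.integral_const_mul,
          intervalIntegral.integral_const_mul, intervalIntegral.integral_const] at hmono
        simpa [mul_comm] using hmono
      have hsum := Finset.sum_le_sum fun e (_ : e ∈ Finset.univ) => this e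
      rw [Finset.sum_add_distrib, Finset.sum_add_distrib, ← Finset.mul_sum, ← Finset.mul_sum,
        ← Finset.mul_sum, hmean] at hsum
      linarith
    have h2t : 0 < 1 - 2 * t := by linarith
    have h8 : 1 / 6 * (q ^ 3 * (t ^ 2 * (3 - 2 * t)) * P)
        ≤ 1 / 2 * (q * t ^ 2 / (4 * (1 - 2 * t)) * D) := by linarith
    have h9 : q * t ^ 2 / (4 * (1 - 2 * t)) * (4 * (1 - 2 * t)) = q * t ^ 2 :=
      div_mul_cancel₀ _ (by positivity)
    have h10 := mul_le_mul_of_nonneg_right h8 (show 0 ≤ 4 * (1 - 2 * t) by positivity)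
    have h11 : q * t ^ 2 * ((2 * q) ^ 2 * ((3 - 2 * t) * (1 - 2 * t)) * P)
        ≤ q * t ^ 2 * (3 * D) := by
      have : 1 / 2 * (q * t ^ 2 / (4 * (1 - 2 * t)) * D) * (4 * (1 - 2 * t))
          = 1 / 2 * D * (q * t ^ 2 / (4 * (1 - 2 * t)) * (4 * (1 - 2 * t))) := by ring
      rw [this, h9] at h10
      linarith
    exact le_of_mul_le_mul_left h11 (by positivity)
  -- Letting `t → 0⁺` restores the sharp constant: both sides acquire the same factor `3`.
  have hlim : Tendsto (fun t : ℝ => (2 * q) ^ 2 * ((3 - 2 * t) * (1 - 2 * t)) * P) (𝓝[>] 0)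
      (𝓝 ((2 * q) ^ 2 * ((3 - 2 * 0) * (1 - 2 * 0)) * P)) :=
    (Continuous.tendsto (by fun_prop) 0).mono_left nhdsWithin_le_nhds
  have hsm : Tendsto (fun t : ℝ => t ^ 2 * (4 * q * ∑ e, L e + q / 2 * D)) (𝓝[>] 0)
      (𝓝 (0 ^ 2 * (4 * q * ∑ e, L e + q / 2 * D))) :=
    (Continuous.tendsto (by fun_prop) 0).mono_left nhdsWithin_le_nhds
  have hev := hsm.eventually_lt_const (u := ε ^ 2) (by rw [zero_pow two_ne_zero, zero_mul]; positivity)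
  have := le_of_tendsto hlim (b := 3 * D) (by
    filter_upwards [hev, Ioo_mem_nhdsGT (show (0 : ℝ) < 1 / 4 by norm_num)] with t h1 h2
    exact key t h2.1 h2.2 h1)
  linarith

end TestFunction

end MGraph

/-! ### The two sides of a bridging edge -/

namespace MGraph

variable {V E : Type*} {Γ : MGraph V E} {L : E → ℝ}

theorem JoinedIn.compl_singleton {e : E} (he : Γ.JoinedIn {e}ᶜ (Γ.src e) (Γ.tgt e)) {x y : V}
    (h : Γ.JoinedIn univ x y) : Γ.JoinedIn {e}ᶜ x y := by
  induction h with
  | rel a b h =>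
    obtain ⟨f, -, rfl, rfl⟩ := h
    by_cases hf : f = e
    · rwa [hf]
    · exact Relation.EqvGen.rel _ _ ⟨f, hf, rfl, rfl⟩
  | refl => exact Relation.EqvGen.refl _
  | symm _ _ _ ih => exact ih.symm
  | trans _ _ _ _ _ ih ih' => exact ih.trans _ _ _ ih'

theorem IsBridging.not_joinedIn (hconn : Γ.IsConnected) {e : E} (he : Γ.IsBridging e) :
    ¬ Γ.JoinedIn {e}ᶜ (Γ.src e) (Γ.tgt e) := fun h =>
  he fun x y => h.compl_singleton (hconn.2 x y)

/-- The vertices that are joined to the final vertex of a dart without using its edge. -/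
def farSide (Γ : MGraph V E) (d : E × Bool) : Set V := {x | Γ.JoinedIn {d.1}ᶜ (Γ.dartEnd d) x}

theorem dartEnd_mem_farSide (d : E × Bool) : Γ.dartEnd d ∈ Γ.farSide d := Relation.EqvGen.refl _

theorem dartStart_notMem_farSide (hconn : Γ.IsConnected) {d : E × Bool} (hd : Γ.IsBridging d.1) :
    Γ.dartStart d ∉ Γ.farSide d := by
  have h := hd.not_joinedIn hconn
  obtain ⟨e, _ | _⟩ := d
  · exact h
  · exact fun h' => h (Relation.EqvGen.symm _ _ h')

theorem not_crosses_farSide {d : E × Bool} {f : E} (hf : f ≠ d.1) :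
    ¬ Γ.Crosses (Γ.farSide d) f := by
  have h : Γ.JoinedIn {d.1}ᶜ (Γ.src f) (Γ.tgt f) := Relation.EqvGen.rel _ _ ⟨f, hf, rfl, rfl⟩
  exact not_not.2 ⟨fun h' => Relation.EqvGen.trans _ _ _ h' h,
    fun h' => Relation.EqvGen.trans _ _ _ h' h.symm⟩

/-- No edge other than that of `d'` leaves the intersection of the two far sides: the edge of `d`
has neither endpoint in it, and every other edge respects both sets. Hence the far side of `d'` lies
in that of `d`; it misses the end of `d`, where `d'` starts. -/
theorem farSide_ssubset (hconn : Γ.IsConnected) {d d' : E × Bool} (hd : Γ.IsBridging d.1)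
    (hd' : Γ.IsBridging d'.1) (hne : d'.1 ≠ d.1) (h : Γ.dartStart d' = Γ.dartEnd d) :
    Γ.farSide d' ⊂ Γ.farSide d := by
  have hv : Γ.dartEnd d ∉ Γ.farSide d' := h ▸ dartStart_notMem_farSide hconn hd'
  have hend : Γ.dartEnd d' ∈ Γ.farSide d := by
    have hc := not_not.1 (not_crosses_farSide (Γ := Γ) (d := d) hne)
    have hv' := h ▸ dartEnd_mem_farSide (Γ := Γ) d
    obtain ⟨f, _ | _⟩ := d'
    · exact hc.2 hv'
    · exact hc.1 hv'
  have hsub : Γ.farSide d' ⊆ Γ.farSide d := by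
    intro x hx
    refine ((JoinedIn.mem_iff (S := Γ.farSide d' ∩ Γ.farSide d) (fun f hf => ?_) hx).1
      ⟨dartEnd_mem_farSide d', hend⟩).2
    have h1 := not_not.1 (not_crosses_farSide (Γ := Γ) (d := d') hf)
    by_cases hfd : f = d.1
    · have hs := dartStart_notMem_farSide hconn hd
      refine not_not.2 ?_
      subst hfd
      obtain ⟨f, _ | _⟩ := d <;>
        simp only [dartStart, dartEnd, mem_inter_iff, if_true, if_false, Bool.false_eq_true] at * <;>
        tauto
    · have h2 := not_not.1 (not_crosses_farSide (Γ := Γ) (d := d) hfd)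
      exact not_not.2 (and_congr h1 h2)
  exact ⟨hsub, fun hc => hv (hc (dartEnd_mem_farSide d))⟩

theorem exists_dart_from_dartEnd (hconn : Γ.IsConnected) {d : E × Bool} (hd : Γ.IsBridging d.1)
    (hterm : ¬ Γ.IsTerminal d.1) : ∃ d' : E × Bool, d'.1 ≠ d.1 ∧ Γ.dartStart d' = Γ.dartEnd d := by
  by_contra! hno
  have hsrc : ∀ f, Γ.src f = Γ.dartEnd d → f = d.1 := fun f hf => by
    by_contra hne
    exact hno (f, true) hne hf
  have htgt : ∀ f, Γ.tgt f = Γ.dartEnd d → f = d.1 := fun f hf => by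
    by_contra hne
    exact hno (f, false) hne hf
  have hloop : Γ.src d.1 ≠ Γ.tgt d.1 := fun h =>
    hd.not_joinedIn hconn (h ▸ Relation.EqvGen.refl _)
  apply hterm
  obtain ⟨e, _ | _⟩ := d
  · left
    have h1 : {f | Γ.src f = Γ.src e} = {e} := by
      ext f; exact ⟨hsrc f, fun h => by rw [mem_singleton_iff.1 h]; rfl⟩
    have h2 : {f | Γ.tgt f = Γ.src e} = ∅ := by
      ext f
      simp only [mem_ofPred_eq, mem_empty_iff_false, iff_false]
      intro hf
      have := htgt f hf
      subst this
      exact hloop hf.symm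
    simp [degree, h1, h2]
  · right
    have h1 : {f | Γ.tgt f = Γ.tgt e} = {e} := by
      ext f; exact ⟨htgt f, fun h => by rw [mem_singleton_iff.1 h]; rfl⟩
    have h2 : {f | Γ.src f = Γ.tgt e} = ∅ := by
      ext f
      simp only [mem_ofPred_eq, mem_empty_iff_false, iff_false]
      intro hf
      have := hsrc f hf
      subst this
      exact hloop hf
    simp [degree, h1, h2]

/-- A connected graph all of whose edges are bridging, i.e. a tree, has a terminal edge. -/
theorem exists_not_isBridging [Finite V] [Finite E] [Nonempty E] (hconn : Γ.IsConnected)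
    (hterm : ∀ e, ¬ Γ.IsTerminal e) : ∃ e, ¬ Γ.IsBridging e := by
  by_contra! hall
  -- Descent: without terminal edges, a dart with the smallest far side can be continued, and its
  -- successor has a strictly smaller one.
  obtain ⟨d, hd⟩ := Finite.exists_min fun d : E × Bool => (Γ.farSide d).ncard
  obtain ⟨d', hne, hstart⟩ := exists_dart_from_dartEnd hconn (hall d.1) (hterm d.1)
  exact (hd d').not_gt
    (ncard_lt_ncard (farSide_ssubset hconn (hall d.1) (hall d'.1) hne hstart))

open Classical in
/-- A half period of the cosine on the edge `e₀`, continued by the constants `1` and `-1` on the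
two sides of the edge, minus the constant `m`. -/
noncomputable def cosineOn (hconn : Γ.IsConnected) (e₀ : E) (h₀ : Γ.IsBridging e₀)
    (hL : 0 < L e₀) (m : ℝ) : Γ.TestFunction L where
  toFun := fun e x => (if e = e₀ then Real.cos (Real.pi / L e₀ * x) else
    if Γ.src e ∈ Γ.farSide (e₀, true) then -1 else 1) - m
  deriv := fun e x => if e = e₀ then -Real.sin (Real.pi / L e₀ * x) * (Real.pi / L e₀) else 0
  vertex := fun v => (if v ∈ Γ.farSide (e₀, true) then -1 else 1) - m
  hasDerivAt := fun e x => by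
    refine HasDerivAt.sub_const _ ?_
    by_cases he : e = e₀
    · simp only [if_pos he]
      simpa using ((hasDerivAt_id x).const_mul (Real.pi / L e₀)).cos
    · simp only [if_neg he]
      exact hasDerivAt_const _ _
  continuous_deriv := fun e => by
    by_cases he : e = e₀
    · simp only [if_pos he]; fun_prop
    · simp only [if_neg he]; exact continuous_const
  apply_zero := fun e => by
    by_cases he : e = e₀
    · have := dartStart_notMem_farSide hconn (d := (e₀, true)) h₀
      simp only [dartStart, if_true] at this
      simp [he, this]
    · simp [he]
  apply_length := fun e => by
    by_cases he : e = e₀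
    · have := dartEnd_mem_farSide (Γ := Γ) (e₀, true)
      simp only [dartEnd, if_true] at this
      simp [he, this, hL.ne']
    · have := not_not.1 (not_crosses_farSide (Γ := Γ) (d := (e₀, true)) he)
      simp [he, this]

theorem integral_cos_half_period {ℓ : ℝ} (hℓ : 0 < ℓ) :
    ∫ x in (0 : ℝ)..ℓ, Real.cos (Real.pi / ℓ * x) = 0 := by
  have hc : Real.pi / ℓ ≠ 0 := by positivity
  rw [intervalIntegral.integral_comp_mul_left (fun x => Real.cos x) hc, integral_cos]
  simp [hℓ.ne']

theorem integral_cos_sq_half_period {ℓ : ℝ} (hℓ : 0 < ℓ) :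
    ∫ x in (0 : ℝ)..ℓ, Real.cos (Real.pi / ℓ * x) ^ 2 = ℓ / 2 := by
  have hc : Real.pi / ℓ ≠ 0 := by positivity
  rw [intervalIntegral.integral_comp_mul_left (fun x => Real.cos x ^ 2) hc, integral_cos_sq,
    div_mul_cancel₀ _ hℓ.ne']
  simp
  field_simp

theorem integral_sin_sq_half_period {ℓ : ℝ} (hℓ : 0 < ℓ) :
    ∫ x in (0 : ℝ)..ℓ, Real.sin (Real.pi / ℓ * x) ^ 2 = ℓ / 2 := by
  have hc : Real.pi / ℓ ≠ 0 := by positivity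
  rw [intervalIntegral.integral_comp_mul_left (fun x => Real.sin x ^ 2) hc, integral_sin_sq,
    div_mul_cancel₀ _ hℓ.ne']
  simp
  field_simp

/-! ### Two-sided bounds on the threshold mass -/

variable [Fintype E]

/-- The cosine profile has `∫ ψ'² = (π / L e₀)² L e₀ / 2`, while `∫ ψ² ≥ L e₀ / 2`: the sides of the
edge add to the latter without adding to the former. -/
theorem le_of_isLocalMinimizer_kappa (hconn : Γ.IsConnected) {e₀ : E} (h₀ : Γ.IsBridging e₀)
    (hL : ∀ e, 0 < L e) {μ : ℝ} (hμ : 0 < μ) (hmin : (Γ.kappa L μ).IsLocalMinimizer 6) :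
    μ ≤ (∑ e, L e) * Real.pi / (2 * L e₀) := by
  classical
  have : Nonempty E := ⟨e₀⟩
  have hLpos : 0 < ∑ e, L e := Finset.sum_pos (fun e _ => hL e) Finset.univ_nonempty
  let σ : E → ℝ := fun e => if Γ.src e ∈ Γ.farSide (e₀, true) then -1 else 1
  have hσ2 : ∀ e, σ e ^ 2 = 1 := fun e => by simp only [σ]; split_ifs <;> norm_num
  have hσ : ∀ e, |σ e| = 1 := fun e => by simp only [σ]; split_ifs <;> norm_num
  set R := ∑ e ∈ Finset.univ.erase e₀, L e with hR
  have hR0 : 0 ≤ R := Finset.sum_nonneg fun e _ => (hL e).le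
  have hsplit : ∑ e, L e = L e₀ + R := (Finset.add_sum_erase _ _ (Finset.mem_univ e₀)).symm
  set J := ∑ e ∈ Finset.univ.erase e₀, σ e * L e with hJ
  have hJR : |J| ≤ R := (Finset.abs_sum_le_sum_abs _ _).trans (Finset.sum_le_sum fun e _ => by
    rw [abs_mul, hσ, one_mul, abs_of_pos (hL e)])
  -- The mean of the profile: its cosine part integrates to zero over `e₀`, so only the constants
  -- `±1` contribute.
  set m := J / ∑ e, L e with hm
  have hmL : m * ∑ e, L e = J := div_mul_cancel₀ _ hLpos.ne'
  have hRL : R ≤ ∑ e, L e := by linarith [hL e₀]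
  have hm1 : |m| ≤ 1 := by
    rw [hm, abs_div, abs_of_pos hLpos, div_le_one hLpos]
    exact hJR.trans hRL
  let ψ : Γ.TestFunction L := cosineOn hconn e₀ h₀ (hL e₀) m
  have hψ₀ : ∀ x, ψ.toFun e₀ x = Real.cos (Real.pi / L e₀ * x) - m := fun x => by
    simp [ψ, cosineOn]
  have hψ₁ : ∀ e ∈ Finset.univ.erase e₀, ∀ x, ψ.toFun e x = σ e - m := fun e he x => by
    simp [ψ, cosineOn, σ, Finset.ne_of_mem_erase he]
  have hd₀ : ∀ x, ψ.deriv e₀ x = -Real.sin (Real.pi / L e₀ * x) * (Real.pi / L e₀) := fun x => by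
    simp [ψ, cosineOn]
  have hd₁ : ∀ e ∈ Finset.univ.erase e₀, ∀ x, ψ.deriv e x = 0 := fun e he x => by
    simp [ψ, cosineOn, Finset.ne_of_mem_erase he]
  have hic : IntervalIntegrable (fun x => Real.cos (Real.pi / L e₀ * x)) volume 0 (L e₀) :=
    Continuous.intervalIntegrable (by fun_prop) _ _
  have hic2 : IntervalIntegrable (fun x => Real.cos (Real.pi / L e₀ * x) ^ 2) volume 0 (L e₀) :=
    Continuous.intervalIntegrable (by fun_prop) _ _
  have hbound : ∀ e x, |ψ.toFun e x| ≤ 2 := by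
    intro e x
    by_cases he : e = e₀
    · subst he
      rw [hψ₀]
      exact (abs_sub _ _).trans (by linarith [Real.abs_cos_le_one (Real.pi / L e * x)])
    · rw [hψ₁ e (Finset.mem_erase.2 ⟨he, Finset.mem_univ e⟩)]
      exact (abs_sub _ _).trans (by linarith [hσ e])
  have hmean : ∑ e, ∫ x in (0 : ℝ)..(L e), ψ.toFun e x = 0 := by
    rw [← Finset.add_sum_erase _ _ (Finset.mem_univ e₀)]
    have h1 : ∫ x in (0 : ℝ)..(L e₀), ψ.toFun e₀ x = - (m * L e₀) := by
      simp only [hψ₀]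
      rw [intervalIntegral.integral_sub hic (by simp), integral_cos_half_period (hL e₀)]
      simp [mul_comm]
    have h2 : ∑ e ∈ Finset.univ.erase e₀, ∫ x in (0 : ℝ)..(L e), ψ.toFun e x = J - m * R := by
      rw [hJ, hR, Finset.mul_sum, ← Finset.sum_sub_distrib]
      refine Finset.sum_congr rfl fun e he => ?_
      simp only [hψ₁ e he, intervalIntegral.integral_const, smul_eq_mul]
      ring
    rw [h1, h2]
    rw [hsplit] at hmL
    linarith
  have hder : ∑ e, ∫ x in (0 : ℝ)..(L e), ψ.deriv e x ^ 2 = (Real.pi / L e₀) ^ 2 * (L e₀ / 2) := by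
    rw [← Finset.add_sum_erase _ _ (Finset.mem_univ e₀),
      Finset.sum_eq_zero fun e he => by simp [hd₁ e he]]
    simp only [hd₀, mul_pow, neg_sq]
    rw [intervalIntegral.integral_mul_const, integral_sin_sq_half_period (hL e₀)]
    ring
  have hsq : ∑ e, ∫ x in (0 : ℝ)..(L e), ψ.toFun e x ^ 2 = L e₀ / 2 + R - m * J := by
    rw [← Finset.add_sum_erase _ _ (Finset.mem_univ e₀)]
    have h1 : ∫ x in (0 : ℝ)..(L e₀), ψ.toFun e₀ x ^ 2 = L e₀ / 2 + m ^ 2 * L e₀ := by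
      simp only [hψ₀]
      rw [intervalIntegral.integral_congr (g := fun x => Real.cos (Real.pi / L e₀ * x) ^ 2
        - 2 * m * Real.cos (Real.pi / L e₀ * x) + m ^ 2) (fun x _ => by ring),
        intervalIntegral.integral_add (hic2.sub (hic.const_mul _)) (by simp),
        intervalIntegral.integral_sub hic2 (hic.const_mul _), intervalIntegral.integral_const_mul,
        integral_cos_half_period (hL e₀), integral_cos_sq_half_period (hL e₀)]
      simp [mul_comm]
    have h2 : ∑ e ∈ Finset.univ.erase e₀, ∫ x in (0 : ℝ)..(L e), ψ.toFun e x ^ 2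
        = R - 2 * m * J + m ^ 2 * R := by
      rw [hJ, hR, Finset.mul_sum, Finset.mul_sum, ← Finset.sum_sub_distrib,
        ← Finset.sum_add_distrib]
      refine Finset.sum_congr rfl fun e he => ?_
      simp only [hψ₁ e he, intervalIntegral.integral_const, smul_eq_mul]
      linear_combination L e * hσ2 e
    rw [h1, h2]
    rw [hsplit] at hmL
    linear_combination m * hmL
  have hmain := ψ.le_of_isLocalMinimizer_kappa hL hμ hmin hbound hmean
  rw [hder, hsq] at hmain
  -- Subtracting the mean costs `m J`, which is at most the contribution `R` of the two sides.
  have hmJ : m * J ≤ R := by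
    refine (le_abs_self _).trans ?_
    rw [abs_mul]
    exact (mul_le_of_le_one_left (abs_nonneg _) hm1).trans hJR
  have hLe := hL e₀
  have h2 : (2 * (μ / ∑ e, L e)) ^ 2 ≤ (Real.pi / L e₀) ^ 2 := by
    refine le_of_mul_le_mul_right (a := L e₀ / 2) (le_trans ?_ hmain) (by positivity)
    gcongr
    linarith
  have h3 : 2 * (μ / ∑ e, L e) ≤ Real.pi / L e₀ := le_of_sq_le_sq h2 (by positivity)
  rw [mul_div_assoc', div_le_div_iff₀ hLpos hLe] at h3
  rw [le_div_iff₀ (by positivity)]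
  linarith

/-- Needed for the lower bounds on `mu1`: the real supremum of an unbounded set is `0` by
convention. -/
theorem bddAbove_of_isBridging (hconn : Γ.IsConnected) {e₀ : E} (h₀ : Γ.IsBridging e₀)
    (hL : ∀ e, 0 < L e) : BddAbove {μ : ℝ | 0 < μ ∧ (Γ.kappa L μ).IsLocalMinimizer 6} :=
  ⟨_, fun _ h => le_of_isLocalMinimizer_kappa hconn h₀ hL h.1 h.2⟩

theorem mu1_le (hconn : Γ.IsConnected) {e₀ : E} (h₀ : Γ.IsBridging e₀) (hL : ∀ e, 0 < L e) :
    Γ.mu1 L 6 ≤ (∑ e, L e) * Real.pi / (2 * L e₀) := by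
  refine Real.sSup_le (fun _ h => le_of_isLocalMinimizer_kappa hconn h₀ hL h.1 h.2) ?_
  have := Finset.sum_nonneg fun e (_ : e ∈ Finset.univ) => (hL e).le
  have := hL e₀
  positivity

theorem CutWeightGE.le_mu1 [Nonempty E] {ω : E → ℝ} {k : ℝ} (hcut : Γ.CutWeightGE ω k)
    (hω : ∀ e, 1 ≤ ω e) (hk0 : 0 < k) (hk : k ≤ 2) (hL : ∀ e, 0 < L e)
    (hbdd : BddAbove {μ : ℝ | 0 < μ ∧ (Γ.kappa L μ).IsLocalMinimizer 6}) :
    k * Real.pi / 2 * ((∑ e, L e) / ∑ e, ω e ^ 2 * L e) ≤ Γ.mu1 L 6 := by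
  have hLpos : 0 < ∑ e, L e := Finset.sum_pos (fun e _ => hL e) Finset.univ_nonempty
  have hWpos : 0 < ∑ e, ω e ^ 2 * L e := Finset.sum_pos (fun e _ =>
    mul_pos (pow_pos (zero_lt_one.trans_le (hω e)) 2) (hL e)) Finset.univ_nonempty
  by_contra! hlt
  -- The maximum with `0` ensures that the chosen mass is positive.
  obtain ⟨μ, h1, h2⟩ := exists_between (max_lt hlt
    (show 0 < k * Real.pi / 2 * ((∑ e, L e) / ∑ e, ω e ^ 2 * L e) by positivity))
  have hμ0 : 0 < μ := (le_max_right _ _).trans_lt h1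
  refine ((le_max_left _ _).trans_lt h1).not_ge (le_csSup hbdd ⟨hμ0, ?_⟩)
  refine hcut.isLocalMinimizer_kappa hω hk0.le hk hL hμ0.le ?_
  rw [mul_div_assoc', div_lt_div_iff₀ hLpos hWpos]
  rw [← mul_div_assoc, lt_div_iff₀ hWpos] at h2
  linarith

end MGraph

/-! ### The limits of long and short bridging edges -/

theorem theorem4 {V E : Type*} [Fintype V] [Fintype E] (Γ : MGraph V E)
    (hconn : Γ.IsConnected)
    (hterm : ∀ e, ¬ Γ.IsTerminal e)
    (hcyc : ¬ Γ.HasCycleCovering)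
    -- the lengths of the edges of `𝒢_ℓ`, for `ℓ > 0`
    (L : ℝ → E → ℝ)
    (hpos : ∀ ℓ > 0, ∀ e, 0 < L ℓ e)
    -- the rest of the graph does not depend on `ℓ`
    (hfix : ∀ e, ¬ Γ.IsBridging e → ∃ c, ∀ ℓ > 0, L ℓ e = c)
    -- the longest bridging edge has length `ℓ`
    (hlong : ∀ ℓ > 0, IsGreatest {s | ∃ e, Γ.IsBridging e ∧ L ℓ e = s} ℓ) :
    -- for `ℓ → ∞`, the bridging edges other than the longest one (if any) stay bounded
    ((∃ C, ∀ ℓ > 0, ∃ e₀, Γ.IsBridging e₀ ∧ L ℓ e₀ = ℓ ∧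
        ∀ e, Γ.IsBridging e → e ≠ e₀ → L ℓ e ≤ C) →
      Tendsto (fun ℓ => Γ.mu1 (L ℓ) 6) atTop (𝓝 (Real.pi / 2))) ∧
    ((Real.pi : ℝ) : EReal) ≤ liminf (fun ℓ => ((Γ.mu1 (L ℓ) 6 : ℝ) : EReal)) (𝓝[>] 0) := by
  have hE : Nonempty E := by
    obtain ⟨e, -⟩ := (hlong 1 one_pos).1
    exact ⟨e⟩
  have hfix' : ∀ e, ¬ Γ.IsBridging e → ∀ ℓ > 0, L ℓ e = L 1 e := fun e he ℓ hℓ => by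
    obtain ⟨c, hc⟩ := hfix e he
    rw [hc ℓ hℓ, hc 1 one_pos]
  have hbdd : ∀ ℓ > 0, BddAbove {μ : ℝ | 0 < μ ∧ (Γ.kappa (L ℓ) μ).IsLocalMinimizer 6} :=
    fun ℓ hℓ => by
      obtain ⟨e, he, -⟩ := (hlong ℓ hℓ).1
      exact MGraph.bddAbove_of_isBridging hconn he (hpos ℓ hℓ)
  constructor
  · rintro ⟨C, hC⟩
    -- `K` bounds the total length apart from `e₀`, uniformly in `ℓ` and in the choice of `e₀`,
    -- which may vary with `ℓ`; each edge is charged for both the bridging and the non-bridging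
    -- case.
    set K := ∑ e, (|C| + L 1 e)
    have hupper : ∀ ℓ > 0, Γ.mu1 (L ℓ) 6 ≤ Real.pi / 2 * (1 + K * ℓ⁻¹) := fun ℓ hℓ => by
      obtain ⟨e₀, he₀, hℓe, hother⟩ := hC ℓ hℓ
      have hsum : ∑ e, L ℓ e ≤ ℓ + K := by
        classical
        calc ∑ e, L ℓ e ≤ ∑ e, ((if e = e₀ then ℓ else 0) + (|C| + L 1 e)) := by
              refine Finset.sum_le_sum fun e _ => ?_
              have h1 := (hpos 1 one_pos e).le
              have h2 := abs_nonneg C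
              split_ifs with h
              · rw [h, hℓe]
                rw [h] at h1
                linarith
              · by_cases hb : Γ.IsBridging e
                · linarith [hother e hb h, le_abs_self C]
                · linarith [hfix' e hb ℓ hℓ]
          _ = ℓ + K := by
              rw [Finset.sum_add_distrib, Finset.sum_ite_eq' Finset.univ e₀,
                if_pos (Finset.mem_univ e₀)]
      refine (MGraph.mu1_le hconn he₀ (hpos ℓ hℓ)).trans ?_
      rw [hℓe, div_le_iff₀ (by positivity)]
      have : Real.pi / 2 * (1 + K * ℓ⁻¹) * (2 * ℓ) = (ℓ + K) * Real.pi := by field_simp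
      rw [this]
      gcongr
    have hlower : ∀ ℓ > 0, Real.pi / 2 ≤ Γ.mu1 (L ℓ) 6 := fun ℓ hℓ => by
      have h := hconn.cutWeightGE_one.le_mu1 (fun _ => le_rfl) one_pos one_le_two (hpos ℓ hℓ)
        (hbdd ℓ hℓ)
      have hLpos : 0 < ∑ e, L ℓ e :=
        Finset.sum_pos (fun e _ => hpos ℓ hℓ e) Finset.univ_nonempty
      simpa [div_self hLpos.ne'] using h
    have hlim : Tendsto (fun ℓ : ℝ => Real.pi / 2 * (1 + K * ℓ⁻¹)) atTop (𝓝 (Real.pi / 2)) := by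
      simpa using ((tendsto_inv_atTop_zero.const_mul K).const_add 1).const_mul (Real.pi / 2)
    refine tendsto_of_tendsto_of_tendsto_of_le_of_le' tendsto_const_nhds hlim ?_ ?_
    · filter_upwards [eventually_gt_atTop 0] with ℓ hℓ using hlower ℓ hℓ
    · filter_upwards [eventually_gt_atTop 0] with ℓ hℓ using hupper ℓ hℓ
  · obtain ⟨f, hf⟩ := MGraph.exists_not_isBridging hconn hterm
    set N := L 1 f
    have hN : 0 < N := hpos 1 one_pos f
    set n : ℝ := (Fintype.card E : ℝ)
    -- Only bridging edges contribute to `W - |𝒢|`, each at most `(2² - 1) ℓ`, and `W` stays above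
    -- the fixed length `N` of the non-bridging edge `f`.
    have hlower : ∀ ℓ > 0, Real.pi * (1 - 3 * n * ℓ / N) ≤ Γ.mu1 (L ℓ) 6 := fun ℓ hℓ => by
      have h := hconn.cutWeightGE_two.le_mu1 MGraph.one_le_bridgeWeight two_pos le_rfl (hpos ℓ hℓ)
        (hbdd ℓ hℓ)
      refine le_trans ?_ h
      set W := ∑ e, Γ.bridgeWeight e ^ 2 * L ℓ e with hW
      have hω : ∀ e, 1 ≤ Γ.bridgeWeight e ^ 2 := fun e => one_le_pow₀ (MGraph.one_le_bridgeWeight e)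
      have hWN : N ≤ W := by
        calc N = L ℓ f := (hfix' f hf ℓ hℓ).symm
          _ ≤ Γ.bridgeWeight f ^ 2 * L ℓ f :=
            le_mul_of_one_le_left (hpos ℓ hℓ f).le (hω f)
          _ ≤ W := Finset.single_le_sum (f := fun e => Γ.bridgeWeight e ^ 2 * L ℓ e)
            (fun e _ => mul_nonneg (sq_nonneg _) (hpos ℓ hℓ e).le) (Finset.mem_univ f)
      have hdiff : W - ∑ e, L ℓ e ≤ 3 * n * ℓ := by
        calc W - ∑ e, L ℓ e = ∑ e, (Γ.bridgeWeight e ^ 2 * L ℓ e - L ℓ e) := by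
              rw [Finset.sum_sub_distrib]
          _ ≤ ∑ _e : E, 3 * ℓ := by
              refine Finset.sum_le_sum fun e _ => ?_
              by_cases hb : Γ.IsBridging e
              · rw [show Γ.bridgeWeight e = 2 from if_pos hb]
                linarith [(hlong ℓ hℓ).2 ⟨e, hb, rfl⟩]
              · rw [show Γ.bridgeWeight e = 1 from if_neg hb]
                linarith
          _ = 3 * n * ℓ := by
              rw [Finset.sum_const, Finset.card_univ, nsmul_eq_mul]
              ring
      have hW0 : 0 < W := hN.trans_le hWN
      have h1 : 1 - 3 * n * ℓ / N ≤ (∑ e, L ℓ e) / W := by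
        have h2 : (∑ e, L ℓ e) / W = 1 - (W - ∑ e, L ℓ e) / W := by field_simp; ring
        rw [h2]
        have h3 : (W - ∑ e, L ℓ e) / W ≤ 3 * n * ℓ / N :=
          (div_le_div_of_nonneg_right hdiff hW0.le).trans
            (div_le_div_of_nonneg_left (by positivity) hN hWN)
        linarith
      rw [mul_div_cancel_left₀ _ two_ne_zero]
      gcongr
    have hlim : Tendsto (fun ℓ : ℝ => ((Real.pi * (1 - 3 * n * ℓ / N) : ℝ) : EReal)) (𝓝[>] 0)
        (𝓝 (Real.pi : ℝ)) := by
      refine (continuous_coe_real_ereal.tendsto _).comp ?_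
      have : Tendsto (fun ℓ : ℝ => Real.pi * (1 - 3 * n * ℓ / N)) (𝓝 0)
          (𝓝 (Real.pi * (1 - 3 * n * 0 / N))) := Continuous.tendsto (by fun_prop) 0
      simp only [mul_zero, zero_div, sub_zero, mul_one] at this
      exact this.mono_left nhdsWithin_le_nhds
    rw [← hlim.liminf_eq]
    refine liminf_le_liminf ?_
    filter_upwards [self_mem_nhdsWithin] with ℓ hℓ
    exact EReal.coe_le_coe_iff.2 (hlower ℓ hℓ)
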